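/- Let $k$ be an arbitrary field. An endomorphism of $\mathbb{A}^n=\mathbb{A}^n_k$ is a tuple $f=(f_1,\ldots,f_n)$ of polynomials in $k[x_1,\ldots,x_n]$, its degree is $\deg(f)=\max_i\deg(f_i)$, and $\mathrm{Aut}(\mathbb{A}^n)$ is the group of endomorphisms that are invertible for composition. The dynamical degree of $f\in\mathrm{Aut}(\mathbb{A}^n)$ ($n\ge 1$) is the limit $\lambda(f)=\lim_{r\to\infty}\deg(f^r)^{1/r}$, which exists. A linear projection $\pi\colon\mathbb{A}^n\to\mathbb{A}^m$ is the morphism given by a surjective $k$-linear map $k^n\to k^m$, and $f$ preserves the set of fibres of $\pi$ if the image under $f$ of each fibre of $\pi$ is a fibre of $\pi$, where fibres are taken over points with values in an algebraic closure $\bar k$ of $k$ and regarded as subsets of $\bar k^n$. Then: 1. for each $f\in\mathrm{Aut}(\mathbb{A}^2)$, the dynamical degree $\lambda(f)$ is an integer; 2. for each $f\in\mathrm{Aut}(\mathbb{A}^3)$ that preserves the set of fibres of a linear projection $\mathbb{A}^3\to\mathbb{A}^1$ or of a linear projection $\mathbb{A}^3\to\mathbb{A}^2$, the dynamical degree $\lambda(f)$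 is an integer; 3. for each $f\in\mathrm{Aut}(\mathbb{A}^4)$ that preserves the set of fibres of a linear projection $\mathbb{A}^4\to\mathbb{A}^2$, the dynamical degree $\lambda(f)$ is an integer. -/

import Mathlib

/-- A polynomial endomorphism `(f₁, …, fₙ)` of the affine space `𝔸ⁿ` over `k`, given by its
coordinate polynomials `fᵢ ∈ k[x₁, …, xₙ]`. -/
@[ext] structure AffineEnd (k : Type*) [Field k] (n : ℕ) where
  /-- The coordinate polynomials. -/
  coord : Fin n → MvPolynomial (Fin n) k

namespace AffineEnd

/-- The monoid `End(𝔸ⁿ)` under composition: `f * g = f ∘ g`, whose `i`-th coordinate is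
`fᵢ(g₁, …, gₙ)`. The group `Aut(𝔸ⁿ)` is its group of units `(AffineEnd k n)ˣ`. -/
noncomputable instance instMonoid (k : Type*) [Field k] (n : ℕ) : Monoid (AffineEnd k n) where
  mul f g := ⟨fun i => MvPolynomial.bind₁ g.coord (f.coord i)⟩
  one := ⟨fun i => MvPolynomial.X i⟩
  mul_assoc f g h := by
    ext1; funext i
    exact MvPolynomial.bind₁_bind₁ g.coord h.coord (f.coord i)
  one_mul f := by
    ext1; funext i
    exact MvPolynomial.bind₁_X_right f.coord i
  mul_one f := by
    ext1; funext i
    exact congrArg (fun φ => φ (f.coord i)) (MvPolynomial.bind₁_X_left (σ := Fin n) (R := k))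

/-- The degree `deg f = max (deg f₁, …, deg fₙ)`. -/
noncomputable def degree {k : Type*} [Field k] {n : ℕ} (f : AffineEnd k n) : ℕ :=
  Finset.univ.sup fun i => (f.coord i).totalDegree

/-- The (first) dynamical degree `λ(f) = lim_{r → ∞} deg(f ^ r) ^ (1 / r)`. -/
noncomputable def dynamicalDegree {k : Type*} [Field k] {n : ℕ} (f : AffineEnd k n) : ℝ :=
  Filter.limUnder Filter.atTop fun r : ℕ => ((f ^ r).degree : ℝ) ^ (1 / (r : ℝ))

theorem degree_mul_le {k : Type*} [Field k] {n : ℕ} (f g : AffineEnd k n) :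
    (f * g).degree ≤ f.degree * g.degree := by
  refine Finset.sup_le fun i _ => ?_
  change (MvPolynomial.bind₁ g.coord (f.coord i)).totalDegree ≤ _
  rw [MvPolynomial.bind₁, MvPolynomial.aeval_def, MvPolynomial.eval₂_eq]
  refine MvPolynomial.totalDegree_finsetSum_le fun d hd => ?_
  refine (MvPolynomial.totalDegree_mul _ _).trans ?_
  rw [MvPolynomial.algebraMap_eq, MvPolynomial.totalDegree_C, zero_add]
  refine (MvPolynomial.totalDegree_finsetProd _ _).trans ?_
  calc ∑ j ∈ d.support, (g.coord j ^ d j).totalDegree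
      ≤ ∑ j ∈ d.support, d j * g.degree := Finset.sum_le_sum fun j _ =>
        (MvPolynomial.totalDegree_pow _ _).trans (Nat.mul_le_mul_left _
          (Finset.le_sup (f := fun i => (g.coord i).totalDegree) (Finset.mem_univ j)))
    _ = (d.sum fun _ e => e) * g.degree := by rw [Finsupp.sum, Finset.sum_mul]
    _ ≤ f.degree * g.degree := Nat.mul_le_mul_right _
        ((MvPolynomial.le_totalDegree hd).trans
          (Finset.le_sup (f := fun i => (f.coord i).totalDegree) (Finset.mem_univ i)))

/-- The limit that defines the dynamical degree exists. -/
theorem tendsto_dynamicalDegree {k : Type*} [Field k] {n : ℕ} (f : AffineEnd k n) :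
    Filter.Tendsto (fun r : ℕ => ((f ^ r).degree : ℝ) ^ (1 / (r : ℝ))) Filter.atTop
      (nhds f.dynamicalDegree) := by
  refine tendsto_nhds_limUnder ?_
  have hmul : ∀ r s : ℕ, (f ^ (r + s)).degree ≤ (f ^ r).degree * (f ^ s).degree := fun r s => by
    rw [pow_add]; exact degree_mul_le _ _
  by_cases h0 : ∃ N, (f ^ N).degree = 0
  · obtain ⟨N, hN⟩ := h0
    refine ⟨0, tendsto_const_nhds.congr' ?_⟩
    filter_upwards [Filter.eventually_ge_atTop (N + 1)] with r hr
    have hz : (f ^ r).degree = 0 := by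
      have := hmul N (r - N)
      rw [hN, zero_mul, Nat.add_sub_cancel' (by omega)] at this
      omega
    have hr0 : (r : ℝ) ≠ 0 := by
      have : r ≠ 0 := by omega
      exact_mod_cast this
    rw [hz, Nat.cast_zero, Real.zero_rpow (one_div_ne_zero hr0)]
  · push Not at h0
    have hpos : ∀ r, (0 : ℝ) < ((f ^ r).degree : ℝ) := fun r => by
      exact_mod_cast Nat.pos_of_ne_zero (h0 r)
    have hsub : Subadditive fun r : ℕ => Real.log ((f ^ r).degree : ℝ) := fun r s => by
      rw [← Real.log_mul (hpos r).ne' (hpos s).ne']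
      exact Real.log_le_log (hpos _) (by exact_mod_cast hmul r s)
    have hbdd : BddBelow (Set.range fun r : ℕ => Real.log ((f ^ r).degree : ℝ) / (r : ℝ)) := by
      refine ⟨0, ?_⟩
      rintro _ ⟨r, rfl⟩
      exact div_nonneg (Real.log_natCast_nonneg _) (Nat.cast_nonneg r)
    refine ⟨Real.exp hsub.lim, ((Real.continuous_exp.tendsto _).comp
      (hsub.tendsto_lim hbdd)).congr fun r => ?_⟩
    rw [Function.comp_apply, Real.rpow_def_of_pos (hpos r), mul_one_div]

/-- The map `Kⁿ → Kⁿ` induced by an endomorphism of `𝔸ⁿ` on points with values in an extension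
`K` of `k`. -/
noncomputable def onPoints {k : Type*} [Field k] {n : ℕ} (f : AffineEnd k n)
    (K : Type*) [Field K] [Algebra k K] (x : Fin n → K) : Fin n → K :=
  fun i => MvPolynomial.aeval x (f.coord i)

end AffineEnd

/-- A linear projection `𝔸ⁿ → 𝔸ᵐ` over `k`: a surjective linear map `kⁿ → kᵐ`, given by its
matrix. -/
structure LinearProjection (k : Type*) [Field k] (n m : ℕ) where
  /-- The matrix of the projection. -/
  matrix : Matrix (Fin m) (Fin n) k
  /-- The projection is surjective. -/
  surjective : Function.Surjective matrix.mulVec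

namespace LinearProjection

/-- The map `Kⁿ → Kᵐ` induced by a linear projection on points with values in an extension `K`
of `k`. -/
def onPoints {k : Type*} [Field k] {n m : ℕ} (π : LinearProjection k n m)
    (K : Type*) [Field K] [Algebra k K] (x : Fin n → K) : Fin m → K :=
  (π.matrix.map (algebraMap k K)).mulVec x

/-- The set of (geometric) fibres of a linear projection, where the fibre over a point of `𝔸ᵐ` with
values in the algebraic closure of `k` is given by its set of points with values in this
algebraic closure. -/
def fibres {k : Type*} [Field k] {n m : ℕ} (π : LinearProjection k n m) :
    Set (Set (Fin n → AlgebraicClosure k)) :=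
  Set.range fun a : Fin m → AlgebraicClosure k => π.onPoints (AlgebraicClosure k) ⁻¹' {a}

end LinearProjection

/-- The endomorphism `f` of `𝔸ⁿ` preserves the set of fibres of the linear projection `π`: the image
under `f` of every fibre of `π` is again a fibre of `π`. -/
def AffineEnd.PreservesFibres {k : Type*} [Field k] {n m : ℕ} (f : AffineEnd k n)
    (π : LinearProjection k n m) : Prop :=
  ∀ F ∈ π.fibres, f.onPoints (AlgebraicClosure k) '' F ∈ π.fibres

/-! The plane case rests on the theorem of Jung and van der Kulk, proved here over any field. Let φ
be a plane automorphism of degree greater than 1, and give the k-th variable the weight deg φ_k.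
Some coordinate ψ_i of φ⁻¹ has a top weighted part p of weight greater than 1. Since ψ_i(φ) = x_i
has degree 1, p vanishes on the leading forms f, g of φ. This forces f^a = c g^b with a, b coprime,
and x^a - c y^b divides p (`exists_binomial_dvd`). A translation of the source that fixes the i-th
coordinate, conjugated by φ, is a deformation H of the identity with parameter t that leaves ψ_i
invariant. For a suitable weight of t, its top part is still non-constant in t and leaves x^a - c
y^b invariant. Comparing degrees in t by means of the Hamiltonian derivation of this binomial
excludes a, b ≥ 2 (`degreeOf_eq_zero_of_pow_sub_pow_eq`). So one leading form is a multiple of a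
power of the other, the degree can be reduced, and the affine and triangular automorphisms generate
the group.

Let s act on the coefficients through an endomorphism of the field. By a twisted conjugation g ↦
s(θ) g θ⁻¹, every plane automorphism becomes affine, triangular or an alternating product of both
kinds (`exists_twisted_conj`). In the first two cases the twisted powers have bounded degree. In the
third the leading part is (H, 0) with H(1, 0) ≠ 0; this shape is stable under composition, so
degrees multiply and the growth rate is the degree D. With s trivial this is the plane case.

If f preserves the fibres of a linear projection, a linear change of coordinates makes it a skew
product over an automorphism g of the base. Its generic fibre is an automorphism over the function
field of the base, and the iterates of f induce twisted powers there, the twist being the pullback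
by g. The inequality `IsSkewOver.degree_mul_le` yields that λ(f) is the maximum of λ(g) and the
growth rate of the generic fibre. Both are integers when base and fibre have dimension 1 or 2; in
dimension 1 every automorphism has degree 1. -/

section

/-! ### Top weighted parts and substitution -/

namespace MvPolynomial

variable {σ τ R : Type*} [CommRing R]

/-- All monomials of `p` have weight at most `N`. -/
def WeightLE (w : σ → ℚ) (p : MvPolynomial σ R) (N : ℚ) : Prop :=
  ∀ d ∈ p.support, Finsupp.weight w d ≤ N

theorem WeightLE.mul {w : σ → ℚ} {p q : MvPolynomial σ R} {a b : ℚ}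
    (hp : WeightLE w p a) (hq : WeightLE w q b) : WeightLE w (p * q) (a + b) := by
  classical
  intro d hd
  obtain ⟨x, hx, y, hy, rfl⟩ := Finset.mem_add.1 (support_mul p q hd)
  rw [map_add]
  exact add_le_add (hp x hx) (hq y hy)

/-- Two monomials of weights at most a and b whose product has weight a + b must have weights
exactly a and b, so no other products contribute. -/
theorem WeightLE.weightedHomogeneousComponent_mul {w : σ → ℚ} {p q : MvPolynomial σ R} {a b : ℚ}
    (hp : WeightLE w p a) (hq : WeightLE w q b) :
    weightedHomogeneousComponent w (a + b) (p * q) =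
      weightedHomogeneousComponent w a p * weightedHomogeneousComponent w b q := by
  classical
  ext d
  rw [coeff_weightedHomogeneousComponent]
  split_ifs with hd
  · rw [coeff_mul, coeff_mul]
    refine Finset.sum_congr rfl fun x hx => ?_
    rw [coeff_weightedHomogeneousComponent, coeff_weightedHomogeneousComponent]
    have hsum : Finsupp.weight w x.1 + Finsupp.weight w x.2 = a + b := by
      rw [← map_add, Finset.HasAntidiagonal.mem_antidiagonal.1 hx, hd]
    by_cases h1 : x.1 ∈ p.support
    · by_cases h2 : x.2 ∈ q.support
      · have := hp _ h1
        have := hq _ h2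
        rw [if_pos (by linarith), if_pos (by linarith)]
      · rw [notMem_support_iff.1 h2]; simp
    · rw [notMem_support_iff.1 h1]; simp
  · refine ((((weightedHomogeneousComponent_isWeightedHomogeneous a p).mul
      (weightedHomogeneousComponent_isWeightedHomogeneous b q)).coeff_eq_zero d hd)).symm

theorem weightedHomogeneousComponent_one_zero (w : σ → ℚ) :
    weightedHomogeneousComponent w 0 (1 : MvPolynomial σ R) = 1 :=
  (isWeightedHomogeneous_one R w).weightedHomogeneousComponent_same

theorem weightLE_one (w : σ → ℚ) : WeightLE w (1 : MvPolynomial σ R) 0 := by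
  classical
  intro d hd
  rw [← C_1, mem_support_iff, coeff_C] at hd
  have : 0 = d := by by_contra h; simp [h] at hd
  simp [← this]

theorem WeightLE.pow {w : σ → ℚ} {p : MvPolynomial σ R} {a : ℚ} (hp : WeightLE w p a) (n : ℕ) :
    WeightLE w (p ^ n) (n • a) ∧
      weightedHomogeneousComponent w (n • a) (p ^ n) =
        weightedHomogeneousComponent w a p ^ n := by
  induction n with
  | zero => simpa using ⟨weightLE_one w, weightedHomogeneousComponent_one_zero w⟩
  | succ n ih =>
    rw [pow_succ, pow_succ, succ_nsmul, ih.1.weightedHomogeneousComponent_mul hp, ih.2]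
    exact ⟨ih.1.mul hp, rfl⟩

theorem WeightLE.prod {ι : Type*} {w : σ → ℚ} (s : Finset ι) {p : ι → MvPolynomial σ R}
    {a : ι → ℚ} (hp : ∀ i, WeightLE w (p i) (a i)) :
    WeightLE w (∏ i ∈ s, p i) (∑ i ∈ s, a i) ∧
      weightedHomogeneousComponent w (∑ i ∈ s, a i) (∏ i ∈ s, p i) =
        ∏ i ∈ s, weightedHomogeneousComponent w (a i) (p i) := by
  classical
  induction s using Finset.induction_on with
  | empty => simpa using ⟨weightLE_one w, weightedHomogeneousComponent_one_zero w⟩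
  | insert i s hi ih =>
    rw [Finset.prod_insert hi, Finset.sum_insert hi, Finset.prod_insert hi,
      (hp i).weightedHomogeneousComponent_mul ih.1, ih.2]
    exact ⟨(hp i).mul ih.1, rfl⟩

theorem WeightLE.weightedHomogeneousComponent_eq_zero {w : σ → ℚ} {p : MvPolynomial σ R} {a b : ℚ}
    (hp : WeightLE w p a) (hab : a < b) : weightedHomogeneousComponent w b p = 0 :=
  weightedHomogeneousComponent_eq_zero' _ _ fun d hd h => by
    have := hp d hd
    linarith

theorem bind₁_eq_sum (F : σ → MvPolynomial τ R) (p : MvPolynomial σ R) :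
    bind₁ F p = ∑ d ∈ p.support, C (p.coeff d) * ∏ i ∈ d.support, F i ^ d i := by
  rw [bind₁, aeval_def, eval₂_eq]
  rfl

/-- The top weighted homogeneous component of a substitution is the substitution of the top
components. -/
theorem weightedHomogeneousComponent_bind₁ {w : σ → ℚ} {w' : τ → ℚ} {F : σ → MvPolynomial τ R}
    (hF : ∀ i, WeightLE w' (F i) (w i)) {p : MvPolynomial σ R} {N : ℚ} (hp : WeightLE w p N) :
    weightedHomogeneousComponent w' N (bind₁ F p) =
      bind₁ (fun i => weightedHomogeneousComponent w' (w i) (F i))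
        (weightedHomogeneousComponent w N p) := by
  classical
  have key : ∀ d : σ →₀ ℕ, WeightLE w' (∏ i ∈ d.support, F i ^ d i) (Finsupp.weight w d) ∧
      weightedHomogeneousComponent w' (Finsupp.weight w d) (∏ i ∈ d.support, F i ^ d i) =
        ∏ i ∈ d.support, weightedHomogeneousComponent w' (w i) (F i) ^ d i := fun d => by
    have := WeightLE.prod d.support (fun i => ((hF i).pow (d i)).1)
    rw [Finsupp.weight_apply, Finsupp.sum]
    refine ⟨this.1, this.2.trans (Finset.prod_congr rfl fun i _ => ((hF i).pow (d i)).2)⟩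
  rw [bind₁_eq_sum, map_sum, weightedHomogeneousComponent_apply, map_sum, Finset.sum_filter]
  refine Finset.sum_congr rfl fun d hd => ?_
  rw [weightedHomogeneousComponent_C_mul]
  split_ifs with h
  · rw [← h, (key d).2, bind₁_monomial]
  · rw [(key d).1.weightedHomogeneousComponent_eq_zero (lt_of_le_of_ne (hp d hd) h), mul_zero]

end MvPolynomial

end

/-! ### Deformations preserving a binomial x^a - c y^b -/

section

namespace MvPolynomial

theorem degreeOf_pderiv_le {σ R : Type*} [CommRing R] (p : MvPolynomial σ R) {i j : σ}
    (hij : i ≠ j) : degreeOf j (pderiv i p) ≤ degreeOf j p := by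
  classical
  refine degreeOf_le_iff.2 fun d hd => ?_
  rw [mem_support_iff, coeff_pderiv] at hd
  have := monomial_le_degreeOf j (mem_support_iff.2 (left_ne_zero_of_mul hd))
  simpa [Finsupp.single_apply, hij] using this

/-- The chain rule when only the i-th component depends on the i-th variable, with derivative 1. It
lets the specialization t = 0 commute with the derivatives in x and y. -/
theorem pderiv_bind₁_eq {σ R : Type*} [CommRing R] [DecidableEq σ] {F : σ → MvPolynomial σ R} {i : σ}
    (hF : ∀ j, pderiv i (F j) = if j = i then 1 else 0) (p : MvPolynomial σ R) :
    pderiv i (bind₁ F p) = bind₁ F (pderiv i p) := by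
  induction p using MvPolynomial.induction_on with
  | C c => simp
  | add p q hp hq => simp [hp, hq]
  | mul_X p j hp =>
    rw [map_mul, bind₁_X_right, pderiv_mul, hp, pderiv_mul, hF, map_add, map_mul, map_mul,
      bind₁_X_right, pderiv_X]
    by_cases h : j = i
    · subst h; simp
    · simp [h]

variable {K : Type*} [Field K]

variable (K) in
/-- The substitution of `0` for the last of three variables. -/
noncomputable abbrev lastZero : MvPolynomial (Fin 3) K →ₐ[K] MvPolynomial (Fin 3) K :=
  bind₁ ![X 0, X 1, 0]

theorem natCast_ne_zero_of_coprime {a b : ℕ} (hab : a.Coprime b) (hb : (b : K) = 0) :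
    (a : K) ≠ 0 := by
  intro ha
  have h := Nat.gcd_eq_gcd_ab a b
  rw [hab] at h
  have h' := congrArg (Int.cast : ℤ → K) h
  push_cast at h'
  rw [ha, hb] at h'
  simp at h'

/-- When b vanishes in K, differentiation kills both b-th powers and leaves F^(a-1) ∂F = X_i^(a-1).
So F^(a-1) divides a polynomial free of t, and a ≥ 2. -/
theorem degreeOf_eq_zero_of_natCast_eq_zero {a b : ℕ} (ha : 2 ≤ a) (hab : a.Coprime b)
    (hb : (b : K) = 0) {c : K} {i j : Fin 3}
    {F G : MvPolynomial (Fin 3) K} (h2 : i ≠ 2)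
    (heq : F ^ a - C c * G ^ b = X i ^ a - C c * X j ^ b) : degreeOf 2 F = 0 := by
  have hb' : (b : MvPolynomial (Fin 3) K) = 0 := by rw [← C_eq_coe_nat, hb, C_0]
  have ha' : (a : MvPolynomial (Fin 3) K) ≠ 0 := by
    rw [← C_eq_coe_nat, Ne, C_eq_zero]; exact natCast_ne_zero_of_coprime hab hb
  have h := congrArg (pderiv i) heq
  rw [map_sub, map_sub, pderiv_C_mul, pderiv_C_mul, pderiv_pow, pderiv_pow, pderiv_pow, pderiv_pow,
    hb', pderiv_X_self, mul_one] at h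
  simp only [zero_mul, mul_zero, sub_zero, mul_assoc] at h
  have h3 := mul_left_cancel₀ ha' h
  have hX : (X i : MvPolynomial (Fin 3) K) ^ (a - 1) ≠ 0 := pow_ne_zero _ (X_ne_zero i)
  have h4 := congrArg (degreeOf 2) h3
  rw [degreeOf_mul_eq (left_ne_zero_of_mul (h3 ▸ hX)) (right_ne_zero_of_mul (h3 ▸ hX)),
    degreeOf_pow_eq _ _ _ (pow_ne_zero_iff (by omega)|>.1 (left_ne_zero_of_mul (h3 ▸ hX))),
    degreeOf_X_pow_of_ne _ h2.symm] at h4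
  have : (a - 1) * degreeOf 2 F = 0 := by omega
  rcases Nat.mul_eq_zero.1 this with h | h
  · omega
  · exact h

/-- Multiplying the first relation by v and eliminating G^(b-1) v with the second gives P v =
F^(a-1) (F v - c u G). As P is free of t, the degree of F^(a-1) in t is at most that of v. This is
the mechanism of the Mason–Stothers inequality. -/
theorem degreeOf_le_of_hamiltonian {a b : ℕ} {F G P u v : MvPolynomial (Fin 3) K} {c d : K}
    (hP : P ≠ 0) (hPt : degreeOf 2 P = 0) (hb : 1 ≤ b)
    (heq : F ^ a - C d * G ^ b = P) (ha : 1 ≤ a)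
    (huv : C c * F ^ (a - 1) * u = C d * G ^ (b - 1) * v) (hF : F ≠ 0) (hv : v ≠ 0) :
    (a - 1) * degreeOf 2 F ≤ degreeOf 2 v := by
  obtain ⟨a, rfl⟩ := Nat.exists_eq_add_of_le' ha
  obtain ⟨b, rfl⟩ := Nat.exists_eq_add_of_le' hb
  simp only [Nat.add_sub_cancel] at *
  have h : P * v = F ^ a * (F * v - C c * u * G) := by
    rw [← heq]
    linear_combination G * huv
  have hne : P * v ≠ 0 := mul_ne_zero hP hv
  have h2 := congrArg (degreeOf 2) h
  rw [degreeOf_mul_eq hP hv, degreeOf_mul_eq (left_ne_zero_of_mul (h ▸ hne))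
    (right_ne_zero_of_mul (h ▸ hne)), degreeOf_pow_eq _ _ _ hF, hPt] at h2
  omega

theorem degreeOf_eq_zero_of_degreeOf_eq_zero {a b : ℕ} (ha : 2 ≤ a) 
    {F G P : MvPolynomial (Fin 3) K} {c : K} (hPt : degreeOf 2 P = 0)
    (heq : F ^ a - C c * G ^ b = P) (hG : degreeOf 2 G = 0) : degreeOf 2 F = 0 := by
  by_cases hF : F = 0
  · rw [hF, degreeOf_zero]
  have h : F ^ a = P + C c * G ^ b := by rw [← heq]; ring
  have h2 := congrArg (degreeOf 2) h
  have h3 := degreeOf_add_le 2 P (C c * G ^ b)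
  have h4 := degreeOf_C_mul_le (G ^ b) 2 c
  have h5 := degreeOf_pow_le 2 G b
  rw [hG, mul_zero] at h5
  rw [degreeOf_pow_eq _ _ _ hF] at h2
  have h6 : a * degreeOf 2 F = 0 := by
    rw [h2]; rw [hPt] at h3
    have : max 0 (degreeOf 2 (C c * G ^ b)) = 0 := by omega
    omega
  rcases Nat.mul_eq_zero.1 h6 with h | h
  · omega
  · exact h

theorem degreeOf_X_pow_sub {a b : ℕ} {c : K} {i j : Fin 3} (hi : i ≠ 2) (hj : j ≠ 2) :
    degreeOf 2 (X i ^ a - C c * X j ^ b : MvPolynomial (Fin 3) K) = 0 := by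
  rw [sub_eq_add_neg, ← neg_mul, ← C_neg]
  have h3 := degreeOf_add_le 2 (X i ^ a) (C (-c) * X j ^ b : MvPolynomial (Fin 3) K)
  have h4 := degreeOf_C_mul_le (X j ^ b : MvPolynomial (Fin 3) K) 2 (-c)
  rw [degreeOf_X_pow_of_ne _ hj.symm] at h4
  rw [degreeOf_X_pow_of_ne _ hi.symm] at h3
  have : max 0 (degreeOf 2 (C (-c) * X j ^ b : MvPolynomial (Fin 3) K)) = 0 := by omega
  omega

theorem X_pow_sub_ne_zero {a b : ℕ} {c : K} {i j : Fin 3} (hij : i ≠ j) (hb : 1 ≤ b) :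
    (X i ^ a - C c * X j ^ b : MvPolynomial (Fin 3) K) ≠ 0 := by
  intro h
  have := congrArg (eval (Function.update (0 : Fin 3 → K) i 1)) h
  simp [hij.symm, show b ≠ 0 by omega] at this

/-- The equation `F ^ a - c G ^ b = x ^ a - c y ^ b` has no non-constant one-parameter solutions
through `(x, y)`. -/
theorem degreeOf_eq_zero_of_pow_sub_pow_eq {a b : ℕ} (ha : 2 ≤ a) (hb : 2 ≤ b) (hab : a.Coprime b)
    {c : K} (hc : c ≠ 0) {F G : MvPolynomial (Fin 3) K}
    (hF0 : lastZero K F = X 0) (hG0 : lastZero K G = X 1)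
    (heq : F ^ a - C c * G ^ b = X 0 ^ a - C c * X 1 ^ b) :
    degreeOf 2 F = 0 ∧ degreeOf 2 G = 0 := by
  have heq' : G ^ b - C c⁻¹ * F ^ a = X 1 ^ b - C c⁻¹ * X 0 ^ a := by
    have hcc : (C c⁻¹ : MvPolynomial (Fin 3) K) * C c = 1 := by
      rw [← C_mul, inv_mul_cancel₀ hc, C_1]
    linear_combination -(C c⁻¹) * heq + (- (G ^ b) + X 1 ^ b) * hcc
  have hPt := degreeOf_X_pow_sub (K := K) (a := a) (b := b) (c := c) (i := 0) (j := 1)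
    (by decide) (by decide)
  have hPt' := degreeOf_X_pow_sub (K := K) (a := b) (b := a) (c := c⁻¹) (i := 1) (j := 0)
    (by decide) (by decide)
  have hFG : degreeOf 2 F = 0 → degreeOf 2 G = 0 :=
    degreeOf_eq_zero_of_degreeOf_eq_zero hb hPt' heq'
  have hGF : degreeOf 2 G = 0 → degreeOf 2 F = 0 :=
    degreeOf_eq_zero_of_degreeOf_eq_zero ha hPt heq
  -- As a and b are coprime, at most one of them vanishes in K. Both cases are settled by a single
  -- partial derivative.
  by_cases hb0 : (b : K) = 0
  · have := degreeOf_eq_zero_of_natCast_eq_zero ha hab hb0 (by decide) heq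
    exact ⟨this, hFG this⟩
  by_cases ha0 : (a : K) = 0
  · have := degreeOf_eq_zero_of_natCast_eq_zero hb hab.symm ha0 (by decide) heq'
    exact ⟨hGF this, this⟩
  have hF : F ≠ 0 := by rintro rfl; simp [eq_comm] at hF0
  have hG : G ≠ 0 := by rintro rfl; simp [eq_comm] at hG0
  -- With P = x^a - c y^b, these are P_x and P_y. The derivation δ = P_y ∂_x - P_x ∂_y kills P and
  -- does not raise the degree in t. Applied to the equation it gives a F^(a-1) δF = c b G^(b-1) δG.
  set Pu : MvPolynomial (Fin 3) K := (a : MvPolynomial (Fin 3) K) * X 0 ^ (a - 1) with hPu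
  set Pv : MvPolynomial (Fin 3) K := -(C c * ((b : MvPolynomial (Fin 3) K) * X 1 ^ (b - 1))) with hPv
  have hd (H : MvPolynomial (Fin 3) K) :
      degreeOf 2 (Pv * pderiv 0 H - Pu * pderiv 1 H) ≤ degreeOf 2 H := by
    have e1 : Pv * pderiv 0 H - Pu * pderiv 1 H =
        C (-(c * b)) * (X 1 ^ (b - 1) * pderiv 0 H) + C (-a : K) * (X 0 ^ (a - 1) * pderiv 1 H) := by
      rw [hPu, hPv]; simp only [C_neg, C_mul, map_natCast]; ring
    have d1 := degreeOf_C_mul_le (X 1 ^ (b - 1) * pderiv 0 H) 2 (-(c * b))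
    have d2 := degreeOf_C_mul_le (X 0 ^ (a - 1) * pderiv 1 H) 2 (-a : K)
    have d3 := degreeOf_mul_le 2 (X 1 ^ (b - 1)) (pderiv 0 H)
    have d4 := degreeOf_mul_le 2 (X 0 ^ (a - 1)) (pderiv 1 H)
    rw [degreeOf_X_pow_of_ne _ (by decide)] at d3 d4
    have d5 := degreeOf_pderiv_le H (show (0 : Fin 3) ≠ 2 by decide)
    have d6 := degreeOf_pderiv_le H (show (1 : Fin 3) ≠ 2 by decide)
    rw [e1]
    refine (degreeOf_add_le _ _ _).trans (max_le ?_ ?_) <;> omega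
  have hpd (i : Fin 3) (hi : i ≠ 2) (H : MvPolynomial (Fin 3) K) :
      lastZero K (pderiv i H) = pderiv i (lastZero K H) := by
    refine (pderiv_bind₁_eq (fun j => ?_) H).symm
    fin_cases i <;> fin_cases j <;> simp_all [pderiv_X]
  have ha1 : (a : MvPolynomial (Fin 3) K) ≠ 0 := by
    rw [← C_eq_coe_nat, Ne, C_eq_zero]; exact ha0
  have hb1 : (b : MvPolynomial (Fin 3) K) ≠ 0 := by
    rw [← C_eq_coe_nat, Ne, C_eq_zero]; exact hb0
  -- At t = 0, δF becomes δx = P_y, which is nonzero because c and b are nonzero in K. Likewise δG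
  -- becomes δy = -P_x below.
  have hu : Pv * pderiv 0 F - Pu * pderiv 1 F ≠ 0 := fun h => by
    have := congrArg (lastZero K) h
    rw [map_sub, map_mul, map_mul, hpd 0 (by decide), hpd 1 (by decide), hF0] at this
    simp [hPv, hc, hb1, pderiv_X] at this
  have hv : Pv * pderiv 0 G - Pu * pderiv 1 G ≠ 0 := fun h => by
    have := congrArg (lastZero K) h
    rw [map_sub, map_mul, map_mul, hpd 0 (by decide), hpd 1 (by decide), hG0] at this
    simp [hPu, ha1, pderiv_X] at this
  have e0 := congrArg (pderiv 0) heq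
  have e1 := congrArg (pderiv 1) heq
  simp only [map_sub, pderiv_C_mul, pderiv_pow, pderiv_X_self,
    pderiv_X_of_ne (show (0 : Fin 3) ≠ 1 by decide),
    pderiv_X_of_ne (show (1 : Fin 3) ≠ 0 by decide), mul_zero, mul_one, sub_zero, zero_sub] at e0 e1
  have huv : C (a : K) * F ^ (a - 1) * (Pv * pderiv 0 F - Pu * pderiv 1 F) =
      C c * G ^ (b - 1) * (C (b : K) * (Pv * pderiv 0 G - Pu * pderiv 1 G)) := by
    simp only [map_natCast, hPu, hPv]
    linear_combination (-(C c * ((b : MvPolynomial (Fin 3) K) * X 1 ^ (b - 1)))) * e0 - ((a : MvPolynomial (Fin 3) K) * X 0 ^ (a - 1)) * e1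
  have hbC : (C (b : K) : MvPolynomial (Fin 3) K) ≠ 0 := by rwa [Ne, C_eq_zero]
  have haC : (C (a : K) : MvPolynomial (Fin 3) K) ≠ 0 := by rwa [Ne, C_eq_zero]
  have k1 := degreeOf_le_of_hamiltonian (c := (a : K)) (d := c) (X_pow_sub_ne_zero (by decide) (by omega)) hPt
    (by omega) heq (by omega) huv hF (mul_ne_zero hbC hv)
  have huv' : C (c * b : K) * G ^ (b - 1) * (Pv * pderiv 0 G - Pu * pderiv 1 G) =
      C c⁻¹ * F ^ (a - 1) * (C (c * a : K) * (Pv * pderiv 0 F - Pu * pderiv 1 F)) := by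
    have hcc : (C c⁻¹ : MvPolynomial (Fin 3) K) * C c = 1 := by
      rw [← C_mul, inv_mul_cancel₀ hc, C_1]
    simp only [C_mul]
    linear_combination -huv - C (a : K) * F ^ (a - 1) * (Pv * pderiv 0 F - Pu * pderiv 1 F) * hcc
  have k2 := degreeOf_le_of_hamiltonian (c := c * b) (d := c⁻¹)
    (X_pow_sub_ne_zero (by decide) (by omega)) hPt'
    (by omega) heq' (by omega) huv' hG (mul_ne_zero (by rw [C_mul]; exact mul_ne_zero (by rwa [Ne, C_eq_zero]) haC) hu)
  have k3 := k1.trans ((degreeOf_C_mul_le _ _ _).trans (hd G))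
  have k4 := k2.trans ((degreeOf_C_mul_le _ _ _).trans (hd F))
  by_contra hcon
  have hr : degreeOf 2 F ≠ 0 := fun h => hcon ⟨h, hFG h⟩
  have hs : degreeOf 2 G ≠ 0 := fun h => hcon ⟨hGF h, h⟩
  obtain ⟨a, rfl⟩ := Nat.exists_eq_add_of_le' ha
  obtain ⟨b, rfl⟩ := Nat.exists_eq_add_of_le' hb
  simp only [show ∀ n, n + 2 - 1 = n + 1 from fun n => rfl] at k3 k4
  -- Here a and b stand for the former a - 2 and b - 2. Adding (a + 1) deg F ≤ deg G and (b + 1) deg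
  -- G ≤ deg F leaves only the exponents a = b = 2, which are not coprime.
  have k6 : a * degreeOf 2 F + b * degreeOf 2 G = 0 := Nat.le_zero.1 (by linarith)
  have k7 : a = 0 := by
    rcases Nat.mul_eq_zero.1 (Nat.eq_zero_of_add_eq_zero_right k6) with h | h
    · exact h
    · exact absurd h hr
  have k8 : b = 0 := by
    rcases Nat.mul_eq_zero.1 (Nat.eq_zero_of_add_eq_zero_left k6) with h | h
    · exact h
    · exact absurd h hs
  subst k7 k8
  norm_num at hab

end MvPolynomial

end

/-! ### The top part of a one-parameter deformation -/

section

namespace MvPolynomial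

variable {K : Type*} [Field K]

theorem coeff_lastZero (F : MvPolynomial (Fin 3) K) (d : Fin 3 →₀ ℕ) :
    coeff d (lastZero K F) = if d 2 = 0 then coeff d F else 0 := by
  induction F using MvPolynomial.induction_on' with
  | add p q hp hq => rw [map_add, coeff_add, hp, hq, coeff_add]; split_ifs <;> simp
  | monomial e c =>
    have h : ∏ i ∈ e.support, (![X 0, X 1, 0] : Fin 3 → MvPolynomial (Fin 3) K) i ^ e i =
        ∏ i, (![X 0, X 1, 0] : Fin 3 → MvPolynomial (Fin 3) K) i ^ e i :=
      Finsupp.prod_fintype e _ (fun i => pow_zero _)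
    rw [lastZero, bind₁_monomial, h, Fin.prod_univ_three]
    by_cases he : e 2 = 0
    · have : C c * (X 0 ^ e 0 * X 1 ^ e 1 * (0 : MvPolynomial (Fin 3) K) ^ e 2) = monomial e c := by
        rw [monomial_eq, Finsupp.prod_fintype _ _ (fun i => pow_zero _), Fin.prod_univ_three, he,
          pow_zero, pow_zero]
      simp only [Matrix.cons_val]
      rw [this, coeff_monomial]
      by_cases hed : e = d
      · subst hed; simp [he]
      · simp [hed]
    · simp only [Matrix.cons_val]
      rw [zero_pow he, mul_zero, mul_zero, coeff_zero, coeff_monomial]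
      by_cases hed : e = d
      · subst hed; simp [he]
      · simp [hed]

theorem lastZero_eq_self {F : MvPolynomial (Fin 3) K} (hF : degreeOf 2 F = 0) :
    lastZero K F = F := by
  ext d
  rw [coeff_lastZero]
  split_ifs with h
  · rfl
  · by_contra hd
    have := monomial_le_degreeOf 2 (mem_support_iff.2 (Ne.symm hd))
    omega

theorem lastZero_weightedHomogeneousComponent (w : Fin 3 → ℚ) (N : ℚ)
    (F : MvPolynomial (Fin 3) K) :
    lastZero K (weightedHomogeneousComponent w N F) =
      weightedHomogeneousComponent w N (lastZero K F) := by
  classical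
  ext d
  rw [coeff_lastZero, coeff_weightedHomogeneousComponent, coeff_weightedHomogeneousComponent,
    coeff_lastZero]
  split_ifs <;> rfl

/-- A non-constant one-parameter deformation of the identity has a non-constant weighted homogeneous
top part for a suitable weight of the parameter. -/
theorem exists_weight_of_deformation (ω : Fin 2 → ℚ) {H : Fin 2 → MvPolynomial (Fin 3) K}
    (hH : ∀ i, lastZero K (H i) = X i.castSucc) (hne : ∃ i, degreeOf 2 (H i) ≠ 0) :
    ∃ w : Fin 3 → ℚ, (∀ i : Fin 2, w i.castSucc = ω i) ∧ (∀ i, WeightLE w (H i) (ω i)) ∧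
      ∃ i, degreeOf 2 (weightedHomogeneousComponent w (ω i) (H i)) ≠ 0 := by
  classical
  let S : Finset (Fin 2 × (Fin 3 →₀ ℕ)) :=
    Finset.univ.biUnion fun i => ((H i).support.filter fun d => d 2 ≠ 0).image fun d => (i, d)
  have hS : ∀ i d, (i, d) ∈ S ↔ coeff d (H i) ≠ 0 ∧ d 2 ≠ 0 := fun i d => by simp [S]
  have hSne : S.Nonempty := by
    obtain ⟨i, hi⟩ := hne
    by_contra hcon
    refine hi (Nat.le_zero.1 (degreeOf_le_iff.2 fun d hd => ?_))
    by_contra h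
    exact hcon ⟨(i, d), (hS i d).2 ⟨mem_support_iff.1 hd, by omega⟩⟩
  -- The weight of t for which the monomial d of H_i has weight exactly ω i. The minimum over all
  -- monomials involving t keeps every monomial within its bound and puts the minimizer in the top
  -- part. It may be fractional or negative, hence rational weights.
  let v : Fin 2 × (Fin 3 →₀ ℕ) → ℚ := fun x =>
    (ω x.1 - (x.2 0 * ω 0 + x.2 1 * ω 1)) / x.2 2
  obtain ⟨⟨i₀, d₀⟩, h₀, hmin⟩ := S.exists_min_image v hSne
  have hw : ∀ d : Fin 3 →₀ ℕ, Finsupp.weight ![ω 0, ω 1, v (i₀, d₀)] d =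
      d 0 * ω 0 + d 1 * ω 1 + d 2 * v (i₀, d₀) := fun d => by
    rw [Finsupp.weight_apply, Finsupp.sum_fintype _ _ (by simp), Fin.sum_univ_three]
    simp
  refine ⟨![ω 0, ω 1, v (i₀, d₀)], fun i => by fin_cases i <;> rfl, fun i d hd => ?_, i₀, ?_⟩
  · rw [hw]
    by_cases h2 : d 2 = 0
    · have h := coeff_lastZero (H i) d
      rw [if_pos h2, hH, coeff_X] at h
      have hd' : Finsupp.single i.castSucc 1 = d := by
        by_contra hne'
        rw [if_neg hne'] at h
        exact mem_support_iff.1 hd h.symm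
      subst hd'
      fin_cases i <;> simp
    · have h := hmin (i, d) ((hS i d).2 ⟨mem_support_iff.1 hd, h2⟩)
      have hpos : (0 : ℚ) < d 2 := by exact_mod_cast Nat.pos_of_ne_zero h2
      have h3 : v (i, d) = (ω i - (d 0 * ω 0 + d 1 * ω 1)) / d 2 := rfl
      rw [h3, le_div_iff₀ hpos] at h
      linarith
  · obtain ⟨hc, h2⟩ := (hS i₀ d₀).1 h₀
    have hpos : (0 : ℚ) < d₀ 2 := by exact_mod_cast Nat.pos_of_ne_zero h2
    have hwt : Finsupp.weight ![ω 0, ω 1, v (i₀, d₀)] d₀ = ω i₀ := by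
      rw [hw]
      have : v (i₀, d₀) = (ω i₀ - (d₀ 0 * ω 0 + d₀ 1 * ω 1)) / d₀ 2 := rfl
      rw [this, mul_div_cancel₀ _ hpos.ne']
      ring
    have := monomial_le_degreeOf (f := weightedHomogeneousComponent ![ω 0, ω 1, v (i₀, d₀)] (ω i₀)
      (H i₀)) 2 (m := d₀) (by
        rw [mem_support_iff, coeff_weightedHomogeneousComponent, if_pos hwt]; exact hc)
    omega

theorem rename_eq_bind₁ {σ τ R : Type*} [CommRing R] (f : σ → τ) (p : MvPolynomial σ R) :
    rename f p = bind₁ (fun i => X (f i)) p := by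
  rw [← AlgHom.congr_fun (algHom_ext (f := rename f) (g := bind₁ fun i => X (f i)) fun i => by simp)]

/-- Passing to top parts in p(H) = p shows that the top part of p is invariant under the top part H'
of H. The binomial at H' then divides a nonzero polynomial free of t, so it is free of t itself and
equals its value at t = 0. If a, b ≥ 2, then H' would be free of t, against the choice of the
weight. -/
theorem not_two_le_of_deformation {ω : Fin 2 → ℚ} {H : Fin 2 → MvPolynomial (Fin 3) K}
    (hH : ∀ i, lastZero K (H i) = X i.castSucc) (hne : ∃ i, degreeOf 2 (H i) ≠ 0)
    {p : MvPolynomial (Fin 2) K} (hHp : bind₁ H p = rename Fin.castSucc p) {N : ℚ}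
    (hp : WeightLE ω p N) (hp0 : weightedHomogeneousComponent ω N p ≠ 0) {a b : ℕ}
    (hab : a.Coprime b) {c : K} (hc : c ≠ 0)
    (hdvd : X 0 ^ a - C c * X 1 ^ b ∣ weightedHomogeneousComponent ω N p) :
    ¬ (2 ≤ a ∧ 2 ≤ b) := by
  rintro ⟨ha, hb⟩
  obtain ⟨w, hw, hwH, i, hi⟩ := exists_weight_of_deformation ω hH hne
  have hwX : ∀ i : Fin 2, IsWeightedHomogeneous w (X i.castSucc : MvPolynomial (Fin 3) K) (ω i) :=
    fun i => hw i ▸ isWeightedHomogeneous_X K w i.castSucc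
  have hXc : ∀ i : Fin 2, weightedHomogeneousComponent w (ω i)
      (X i.castSucc : MvPolynomial (Fin 3) K) = X i.castSucc :=
    fun i => (hwX i).weightedHomogeneousComponent_same
  have hwLE : ∀ i : Fin 2, WeightLE w (X i.castSucc : MvPolynomial (Fin 3) K) (ω i) :=
    fun i d hd => (hwX i (mem_support_iff.1 hd)).le
  have h0 : ∀ i, lastZero K (weightedHomogeneousComponent w (ω i) (H i)) = X i.castSucc := fun i => by
    rw [lastZero_weightedHomogeneousComponent, hH, hXc]
  have htop := weightedHomogeneousComponent_bind₁ hwH hp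
  rw [hHp, rename_eq_bind₁, weightedHomogeneousComponent_bind₁ hwLE hp] at htop
  simp only [hXc] at htop
  rw [← rename_eq_bind₁] at htop
  set H' := fun i => weightedHomogeneousComponent w (ω i) (H i) with hH'
  obtain ⟨s, hs⟩ := hdvd
  have hinj := Fin.castSucc_injective 2
  have hdeg : degreeOf 2 (rename Fin.castSucc (weightedHomogeneousComponent ω N p)) = 0 := by
    refine Nat.le_zero.1 (degreeOf_le_iff.2 fun d hd => ?_)
    rw [support_rename_of_injective hinj, Finset.mem_image] at hd
    obtain ⟨e, -, rfl⟩ := hd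
    rw [Finsupp.mapDomain_of_notMem_range]
    rintro ⟨j, hj⟩
    exact (Fin.castSucc_lt_last j).ne hj
  have hne0 : rename Fin.castSucc (weightedHomogeneousComponent ω N p) ≠ 0 :=
    (map_ne_zero_iff _ (rename_injective _ hinj)).2 hp0
  rw [htop, hs, map_mul] at hdeg hne0
  rw [degreeOf_mul_eq (left_ne_zero_of_mul hne0) (right_ne_zero_of_mul hne0)] at hdeg
  have hP : degreeOf 2 (bind₁ H' (X 0 ^ a - C c * X 1 ^ b)) = 0 := by omega
  have hP' := lastZero_eq_self hP
  simp only [map_sub, map_mul, map_pow, bind₁_X_right, bind₁_C_right] at hP'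
  have h00 : lastZero K (H' 0) = X 0 := h0 0
  have h01 : lastZero K (H' 1) = X 1 := h0 1
  rw [h00, h01] at hP'
  have := degreeOf_eq_zero_of_pow_sub_pow_eq ha hb hab hc h00 h01 hP'.symm
  fin_cases i
  · exact hi this.1
  · exact hi this.2

end MvPolynomial

end

/-! ### Weighted homogeneous relations between two forms -/

section

namespace MvPolynomial

variable {K : Type*} [Field K]

/-- Two nonzero forms of the same degree whose ratio is algebraic are proportional. -/
theorem exists_eq_C_mul_of_isAlgebraic {σ : Type*} {U V : MvPolynomial σ K} {n : ℕ}
    (hU : U.IsHomogeneous n) (hV : V.IsHomogeneous n) (hU0 : U ≠ 0) (hV0 : V ≠ 0)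
    (halg : IsAlgebraic K (algebraMap _ (FractionRing (MvPolynomial σ K)) U /
      algebraMap _ (FractionRing (MvPolynomial σ K)) V)) :
    ∃ c : K, c ≠ 0 ∧ U = C c * V := by
  have hint := halg.isIntegral.tower_top (A := MvPolynomial σ K)
  -- The polynomial ring is integrally closed, so the algebraic ratio U / V is a polynomial; it is
  -- constant because U and V have the same degree.
  obtain ⟨s, hs⟩ := IsIntegrallyClosed.algebraMap_eq_of_integral hint
  have hV' : algebraMap _ (FractionRing (MvPolynomial σ K)) V ≠ 0 :=
    (map_ne_zero_iff _ (IsFractionRing.injective _ _)).2 hV0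
  rw [eq_div_iff hV', ← map_mul] at hs
  have hs' := IsFractionRing.injective _ _ hs
  have hs0 : s ≠ 0 := by rintro rfl; exact hU0 (by rw [← hs', zero_mul])
  have hdeg := congrArg totalDegree hs'
  rw [totalDegree_mul_of_isDomain hs0 hV0, hU.totalDegree hU0, hV.totalDegree hV0] at hdeg
  have hsC := totalDegree_eq_zero_iff_eq_C.1 (show s.totalDegree = 0 by omega)
  refine ⟨_, fun h => hs0 ?_, by rw [← hs']; exact congrArg (· * V) hsC⟩
  rw [hsC, h, C_0]

/-- Since a and b are coprime, lattice points on a line of constant weight differ by multiples of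
(a, -b). -/
theorem exists_nat_of_mul_add_mul_eq {a b : ℕ} (hab : a.Coprime b) (ha : 1 ≤ a) {x y x₀ y₀ : ℕ}
    (hx : x₀ ≤ x) (h : x * b + y * a = x₀ * b + y₀ * a) :
    ∃ l, x = x₀ + a * l ∧ y₀ = y + b * l := by
  obtain ⟨k, rfl⟩ := Nat.exists_eq_add_of_le hx
  have h' : k * b + y * a = y₀ * a := by linarith
  have hdvd : a ∣ k := by
    refine hab.dvd_of_dvd_mul_right ?_
    exact (Nat.dvd_add_left (dvd_mul_left a y)).1 (h' ▸ dvd_mul_left a y₀)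
  obtain ⟨l, rfl⟩ := hdvd
  refine ⟨l, rfl, ?_⟩
  have : a * y₀ = a * (y + b * l) := by linarith
  exact Nat.eq_of_mul_eq_mul_left ha this

/-- A weighted homogeneous relation between two forms is divisible by a binomial relation. -/
theorem exists_binomial_dvd {f g : MvPolynomial (Fin 2) K} {a b e M : ℕ} (ha : 1 ≤ a)
    (hab : a.Coprime b) (hf : f.IsHomogeneous (e * b)) (hg : g.IsHomogeneous (e * a)) (hf0 : f ≠ 0)
    (hg0 : g ≠ 0) {p : MvPolynomial (Fin 2) K} (hp0 : p ≠ 0)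
    (hp : ∀ d ∈ p.support, d 0 * b + d 1 * a = M) (hpfg : bind₁ ![f, g] p = 0) :
    ∃ c : K, c ≠ 0 ∧ f ^ a = C c * g ^ b ∧ X 0 ^ a - C c * X 1 ^ b ∣ p := by
  classical
  -- With d₀ of least exponent in the first variable, every other exponent of p is d₀ + l (a, -b)
  -- with l a natural number.
  obtain ⟨d₀, hd₀, hmin⟩ := p.support.exists_min_image (fun d => d 0) (support_nonempty.2 hp0)
  have hl : ∀ d : Fin 2 →₀ ℕ, ∃ l, d ∈ p.support → d 0 = d₀ 0 + a * l ∧ d₀ 1 = d 1 + b * l := by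
    intro d
    by_cases hd : d ∈ p.support
    · obtain ⟨l, hl⟩ := exists_nat_of_mul_add_mul_eq hab ha (hmin d hd) ((hp d hd).trans (hp _ hd₀).symm)
      exact ⟨l, fun _ => hl⟩
    · exact ⟨0, fun h => absurd h hd⟩
  choose l hl using hl
  set L := FractionRing (MvPolynomial (Fin 2) K)
  set ι := algebraMap (MvPolynomial (Fin 2) K) L with hι
  have hinj : Function.Injective ι := IsFractionRing.injective _ _
  have hιg : ι g ≠ 0 := (map_ne_zero_iff _ hinj).2 hg0
  have hιf : ι f ≠ 0 := (map_ne_zero_iff _ hinj).2 hf0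
  set r := ι (f ^ a) / ι (g ^ b) with hr
  have hx : r * ι (g ^ b) = ι (f ^ a) :=
    div_mul_cancel₀ _ ((map_ne_zero_iff _ hinj).2 (pow_ne_zero _ hg0))
  have hbind : ∀ (F G : MvPolynomial (Fin 2) K), bind₁ ![F, G] p =
      ∑ d ∈ p.support, C (p.coeff d) * (F ^ d 0 * G ^ d 1) := fun F G => by
    rw [bind₁_eq_sum]
    refine Finset.sum_congr rfl fun d _ => ?_
    have h : ∏ i ∈ d.support, ![F, G] i ^ d i = ∏ i, ![F, G] i ^ d i :=
      Finsupp.prod_fintype d _ (fun i => pow_zero _)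
    rw [h, Fin.prod_univ_two]
    simp
  -- Dehomogenization: p(f, g) is f^(d₀ 0) g^(d₀ 1) times q(r) with r = f^a / g^b. The exponent l
  -- determines d, so the constant coefficient of q is that of d₀ in p and q is nonzero. Hence r is
  -- algebraic over K.
  let q : Polynomial K := ∑ d ∈ p.support, Polynomial.C (p.coeff d) * Polynomial.X ^ l d
  have hq0 : q ≠ 0 := by
    intro h
    have h2 := congrArg (fun q => Polynomial.coeff q 0) h
    simp only [q, Polynomial.finsetSum_coeff, Polynomial.coeff_C_mul_X_pow,
      Polynomial.coeff_zero] at h2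
    rw [Finset.sum_eq_single d₀] at h2
    · have : l d₀ = 0 := by
        have := (hl d₀ hd₀).1
        have : a * l d₀ = 0 := by omega
        rcases Nat.mul_eq_zero.1 this with h | h
        · omega
        · exact h
      rw [this, if_pos rfl] at h2
      exact mem_support_iff.1 hd₀ h2
    · intro d hd hne
      rw [if_neg]
      intro h0
      refine hne (Finsupp.ext fun i => ?_)
      obtain ⟨h3, h4⟩ := hl d hd
      rw [← h0] at h3 h4
      fin_cases i
      · simpa using h3
      · simpa using h4.symm
    · exact fun h => absurd hd₀ h
  have hqr : Polynomial.aeval r q = 0 := by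
    have h1 : ι (f ^ d₀ 0 * g ^ d₀ 1) * Polynomial.aeval r q = ι (bind₁ ![f, g] p) := by
      rw [hbind, map_sum, map_sum, Finset.mul_sum]
      refine Finset.sum_congr rfl fun d hd => ?_
      obtain ⟨h3, h4⟩ := hl d hd
      rw [map_mul (Polynomial.aeval r), Polynomial.aeval_C, map_pow (Polynomial.aeval r),
        Polynomial.aeval_X, hr, h3, h4, IsScalarTower.algebraMap_apply K (MvPolynomial (Fin 2) K) L,
        algebraMap_eq, ← hι]
      rw [← hr, map_mul ι, map_mul ι, map_mul ι, map_pow ι, map_pow ι, map_pow ι, map_pow ι, pow_add,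
        pow_add, pow_mul, pow_mul, ← map_pow ι f a, ← hx, mul_pow, map_pow ι g b]
      ring
    rw [hpfg, map_zero ι] at h1
    refine (mul_eq_zero.1 h1).resolve_left ?_
    rw [map_mul, map_pow, map_pow]
    exact mul_ne_zero (pow_ne_zero _ hιf) (pow_ne_zero _ hιg)
  obtain ⟨c, hc, hfg⟩ := exists_eq_C_mul_of_isAlgebraic (hf.pow a)
    (show (g ^ b).IsHomogeneous (e * b * a) by
      rw [show e * b * a = e * a * b by ring]; exact hg.pow b)
    (pow_ne_zero _ hf0) (pow_ne_zero _ hg0) ⟨q, hq0, hqr⟩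
  refine ⟨c, hc, hfg, ?_⟩
  set P : MvPolynomial (Fin 2) K := X 0 ^ a - C c * X 1 ^ b with hP
  -- Modulo the binomial, x^a may be replaced by c y^b, which collapses p to a scalar multiple of
  -- the monomial d₀.
  have hdvd : P ∣ p - C (∑ d ∈ p.support, p.coeff d * c ^ l d) * (X 0 ^ d₀ 0 * X 1 ^ d₀ 1) := by
    have h1 : p = bind₁ ![X 0, X 1] p := by
      have : (![X 0, X 1] : Fin 2 → MvPolynomial (Fin 2) K) = X := by
        ext1 i; fin_cases i <;> rfl
      rw [this, bind₁_X_left]; rfl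
    conv_rhs => enter [1]; rw [h1, hbind]
    rw [map_sum, Finset.sum_mul, ← Finset.sum_sub_distrib]
    refine Finset.dvd_sum fun d hd => ?_
    obtain ⟨h3, h4⟩ := hl d hd
    have h5 : C (coeff d p) * (X 0 ^ d 0 * X 1 ^ d 1) -
        C (coeff d p * c ^ l d) * (X 0 ^ d₀ 0 * X 1 ^ d₀ 1) =
        C (coeff d p) * X 0 ^ d₀ 0 * X 1 ^ d 1 *
          ((X 0 ^ a) ^ l d - (C c * X 1 ^ b) ^ l d : MvPolynomial (Fin 2) K) := by
      rw [h3, h4]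
      simp only [C_mul, C_pow]
      ring
    rw [h5]
    exact (sub_dvd_pow_sub_pow _ _ _).mul_left _
  suffices h : (∑ d ∈ p.support, p.coeff d * c ^ l d) = 0 by
    rwa [h, C_0, zero_mul, sub_zero] at hdvd
  obtain ⟨s, hs⟩ := hdvd
  -- At (f, g) both p and the binomial vanish while the monomial d₀ does not, so the scalar is zero.
  have h6 := congrArg (bind₁ ![f, g]) hs
  simp only [hP, map_sub, map_mul, map_pow, bind₁_X_right, bind₁_C_right, hpfg, zero_sub,
    Matrix.cons_val] at h6
  rw [hfg, sub_self, zero_mul, neg_eq_zero] at h6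
  rcases mul_eq_zero.1 h6 with h | h
  · exact C_eq_zero.1 h
  · exact absurd h (mul_ne_zero (pow_ne_zero _ hf0) (pow_ne_zero _ hg0))

theorem weight_one_eq {σ : Type*} (d : σ →₀ ℕ) :
    Finsupp.weight (fun _ => (1 : ℚ)) d = (d.degree : ℚ) := by
  simp [Finsupp.weight_apply, Finsupp.sum, Finsupp.degree_apply]

theorem weightLE_one_iff {σ : Type*} {p : MvPolynomial σ K} {n : ℕ} :
    WeightLE (fun _ => 1) p n ↔ p.totalDegree ≤ n := by
  constructor
  · intro h
    refine Finset.sup_le fun d hd => ?_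
    have := h d hd
    rw [weight_one_eq] at this
    exact_mod_cast this
  · intro h d hd
    rw [weight_one_eq]
    exact_mod_cast (le_totalDegree hd).trans h

theorem weightedHomogeneousComponent_one_eq {σ : Type*} (p : MvPolynomial σ K) (n : ℕ) :
    weightedHomogeneousComponent (fun _ => (1 : ℚ)) n p = homogeneousComponent n p := by
  classical
  ext d
  rw [coeff_weightedHomogeneousComponent, coeff_homogeneousComponent, weight_one_eq]
  simp only [Nat.cast_inj]

theorem bind₁_update_eq_self {σ : Type*} [DecidableEq σ] {p : MvPolynomial σ K} {j : σ}
    (hp : ∀ d ∈ p.support, d j = 0) :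
    bind₁ (Function.update X j 0) p = p := by
  conv_rhs => rw [p.as_sum]
  rw [bind₁_eq_sum]
  refine Finset.sum_congr rfl fun d hd => ?_
  rw [monomial_eq, Finsupp.prod]
  refine congrArg _ (Finset.prod_congr rfl fun i hi => ?_)
  rw [Function.update_of_ne]
  rintro rfl
  exact Finsupp.mem_support_iff.1 hi (hp d hd)

theorem homogeneousComponent_totalDegree_ne_zero {σ : Type*} {p : MvPolynomial σ K} (hp : p ≠ 0) :
    homogeneousComponent p.totalDegree p ≠ 0 := by
  classical
  obtain ⟨d, hd, h⟩ := Finset.exists_mem_eq_sup p.support (support_nonempty.2 hp)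
    fun s => s.sum fun _ e => e
  intro h0
  have h1 := congrArg (coeff d) h0
  rw [coeff_homogeneousComponent, if_pos (show d.degree = p.totalDegree from h.symm)] at h1
  exact mem_support_iff.1 hd h1

theorem totalDegree_sub_lt {σ : Type*} {p q : MvPolynomial σ K} {n : ℕ} (hn : 0 < n)
    (hp : p.totalDegree ≤ n) (hq : q.totalDegree ≤ n)
    (hpq : homogeneousComponent n p = homogeneousComponent n q) : (p - q).totalDegree < n := by
  classical
  refine (Finset.sup_lt_iff hn).2 fun d hd => ?_
  have h1 : (p - q).totalDegree ≤ n := (totalDegree_sub p q).trans (max_le hp hq)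
  have h2 : d.degree ≤ n := (le_totalDegree hd).trans h1
  refine lt_of_le_of_ne h2 fun (h : d.degree = n) => mem_support_iff.1 hd ?_
  have h3 := congrArg (coeff d) hpq
  rw [coeff_homogeneousComponent, coeff_homogeneousComponent, if_pos h, if_pos h] at h3
  rw [coeff_sub, h3, sub_self]

end MvPolynomial

end

/-! ### Degree reduction for automorphisms of the plane -/

section

open MvPolynomial

namespace MvPolynomial

theorem homogeneousComponent_pow {σ K : Type*} [Field K] {p : MvPolynomial σ K} {m : ℕ}
    (hp : p.totalDegree ≤ m) (r : ℕ) :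
    homogeneousComponent (r * m) (p ^ r) = homogeneousComponent m p ^ r := by
  have h := ((weightLE_one_iff.2 hp).pow r).2
  rw [weightedHomogeneousComponent_one_eq, nsmul_eq_mul, ← Nat.cast_mul,
    weightedHomogeneousComponent_one_eq] at h
  exact h

end MvPolynomial

namespace AffineEnd

variable {K : Type*} [Field K] {n : ℕ}

theorem coord_mul (f g : AffineEnd K n) (i : Fin n) :
    (f * g).coord i = bind₁ g.coord (f.coord i) := rfl

theorem coord_one (i : Fin n) : (1 : AffineEnd K n).coord i = X i := rfl

theorem bind₁_inv_coord (φ : (AffineEnd K n)ˣ) (i : Fin n) :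
    bind₁ (φ⁻¹ : (AffineEnd K n)ˣ).1.coord (φ.1.coord i) = X i := by
  rw [← coord_mul, Units.mul_inv, coord_one]

theorem bind₁_coord_inv (φ : (AffineEnd K n)ˣ) (i : Fin n) :
    bind₁ φ.1.coord ((φ⁻¹ : (AffineEnd K n)ˣ).1.coord i) = X i := by
  rw [← coord_mul, Units.inv_mul, coord_one]

theorem totalDegree_coord_pos (φ : (AffineEnd K n)ˣ) (i : Fin n) :
    0 < (φ.1.coord i).totalDegree := by
  by_contra h
  have h1 := totalDegree_eq_zero_iff_eq_C.1 (Nat.le_zero.1 (not_lt.1 h))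
  have h2 := bind₁_inv_coord φ i
  rw [h1, bind₁_C_right] at h2
  have h3 := congrArg totalDegree h2
  rw [totalDegree_C, totalDegree_X] at h3
  omega

theorem totalDegree_coord_le (f : AffineEnd K n) (i : Fin n) :
    (f.coord i).totalDegree ≤ f.degree :=
  Finset.le_sup (f := fun i => (f.coord i).totalDegree) (Finset.mem_univ i)

/-- Translation in the `i`-th source coordinate, transported to the target of `φ`, as a deformation
of the identity. -/
noncomputable def translationDeformation (φ : (AffineEnd K 2)ˣ) (i : Fin 2) (k : Fin 2) :
    MvPolynomial (Fin 3) K :=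
  bind₁ (fun l => rename Fin.castSucc ((φ⁻¹ : (AffineEnd K 2)ˣ).1.coord l) +
    if l = i then 0 else X 2) (φ.1.coord k)

theorem lastZero_rename (p : MvPolynomial (Fin 2) K) :
    lastZero K (rename Fin.castSucc p) = rename Fin.castSucc p := by
  rw [lastZero, bind₁, aeval_rename, rename_eq_bind₁, bind₁]
  congr 2
  ext1 i
  fin_cases i <;> rfl

theorem lastZero_translationDeformation (φ : (AffineEnd K 2)ˣ) (i k : Fin 2) :
    lastZero K (translationDeformation φ i k) = X k.castSucc := by
  rw [translationDeformation, lastZero, bind₁_bind₁]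
  have : (fun l => lastZero K (rename Fin.castSucc ((φ⁻¹ : (AffineEnd K 2)ˣ).1.coord l) +
      if l = i then 0 else X 2)) =
      fun l => rename Fin.castSucc ((φ⁻¹ : (AffineEnd K 2)ˣ).1.coord l) := by
    ext1 l
    rw [map_add, lastZero_rename]
    split_ifs <;> simp
  rw [this]
  have h := congrArg (rename Fin.castSucc) (bind₁_inv_coord φ k)
  rw [rename_X, ← AlgHom.comp_apply] at h
  rw [← h]
  refine AlgHom.congr_fun (algHom_ext fun l => ?_) _
  simp

/-- The deformation is φ(φ⁻¹ + t e), where e is the basis vector other than the i-th. In particular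
the i-th coordinate of φ⁻¹ is invariant under it. -/
theorem bind₁_translationDeformation (φ : (AffineEnd K 2)ˣ) (i l : Fin 2) :
    bind₁ (translationDeformation φ i) ((φ⁻¹ : (AffineEnd K 2)ˣ).1.coord l) =
      rename Fin.castSucc ((φ⁻¹ : (AffineEnd K 2)ˣ).1.coord l) + if l = i then 0 else X 2 := by
  have h : translationDeformation φ i = fun k => bind₁ (fun l =>
      rename Fin.castSucc ((φ⁻¹ : (AffineEnd K 2)ˣ).1.coord l) + if l = i then 0 else X 2)
        (φ.1.coord k) := rfl
  rw [h, ← bind₁_bind₁, bind₁_coord_inv, bind₁_X_right]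

/-- A deformation free of t would be the identity, its value at t = 0, whereas it moves the other
coordinate of φ⁻¹ by t. -/
theorem exists_degreeOf_translationDeformation_ne_zero (φ : (AffineEnd K 2)ˣ) (i : Fin 2) :
    ∃ k, degreeOf 2 (translationDeformation φ i k) ≠ 0 := by
  by_contra! h
  obtain ⟨l, hl⟩ := exists_ne i
  have h1 := bind₁_translationDeformation φ i l
  have h2 : translationDeformation φ i = fun k => X k.castSucc := by
    ext1 k
    rw [← lastZero_translationDeformation φ i k, lastZero_eq_self (h k)]
  rw [h2, ← rename_eq_bind₁, if_neg hl, left_eq_add] at h1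
  exact X_ne_zero _ h1

/-- The inverse of a non-linear automorphism of the plane has a coordinate that is not of weighted
degree at most `1` for the weights given by the degrees of the automorphism. -/
theorem exists_weight_gt_one (φ : (AffineEnd K 2)ˣ) (hφ : 1 < φ.1.degree) :
    ∃ i, ∃ d ∈ ((φ⁻¹ : (AffineEnd K 2)ˣ).1.coord i).support,
      1 < Finsupp.weight (fun k => ((φ.1.coord k).totalDegree : ℚ)) d := by
  by_contra! h
  obtain ⟨j, -, hj⟩ := (Finset.lt_sup_iff).1 hφ
  -- A variable of weight at least 2 cannot occur in monomials of weight at most 1. So x_j is absent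
  -- from φ⁻¹, and setting x_j = 0 in φ_j(φ⁻¹) = x_j gives x_j = 0.
  have h1 : ∀ i, bind₁ (Function.update X j 0) ((φ⁻¹ : (AffineEnd K 2)ˣ).1.coord i) =
      (φ⁻¹ : (AffineEnd K 2)ˣ).1.coord i := fun i => by
    refine bind₁_update_eq_self fun d hd => ?_
    by_contra hdj
    have h2 := h i d hd
    rw [Finsupp.weight_apply, Finsupp.sum] at h2
    have h3 := Finset.single_le_sum
      (f := fun k => d k • ((φ.1.coord k).totalDegree : ℚ))
      (fun k _ => by positivity) (Finsupp.mem_support_iff.2 hdj)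
    have h4 := h3.trans h2
    simp only [nsmul_eq_mul] at h4
    have h5 : d j * (φ.1.coord j).totalDegree ≤ 1 := by exact_mod_cast h4
    have : 1 ≤ d j := by omega
    nlinarith
  have h2 := congrArg (bind₁ (Function.update X j 0)) (bind₁_inv_coord φ j)
  rw [bind₁_bind₁, bind₁_X_right, Function.update_self] at h2
  simp only [h1] at h2
  rw [bind₁_inv_coord] at h2
  exact X_ne_zero _ h2

/-- The degree of a non-linear automorphism of the plane can be reduced by subtracting a multiple of
a power of one coordinate from the other. -/
theorem exists_totalDegree_sub_lt (φ : (AffineEnd K 2)ˣ) (hφ : 1 < φ.1.degree) :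
    ∃ i j : Fin 2, i ≠ j ∧ ∃ (c : K) (e : ℕ),
      (φ.1.coord i - C c * φ.1.coord j ^ e).totalDegree < (φ.1.coord i).totalDegree := by
  classical
  set m := fun k => (φ.1.coord k).totalDegree with hm
  set ω : Fin 2 → ℚ := fun k => (m k : ℚ) with hω
  set ψ := (φ⁻¹ : (AffineEnd K 2)ˣ).1.coord with hψ
  obtain ⟨i, d₁, hd₁, hd₁w⟩ := exists_weight_gt_one φ hφ
  obtain ⟨d₀, hd₀, hmax⟩ := (ψ i).support.exists_max_image (Finsupp.weight ω) ⟨d₁, hd₁⟩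
  set N := Finsupp.weight ω d₀ with hN
  have hN1 : 1 < N := hd₁w.trans_le (hmax d₁ hd₁)
  have hLE : WeightLE ω (ψ i) N := hmax
  set p := weightedHomogeneousComponent ω N (ψ i) with hp
  have hp0 : p ≠ 0 := by
    intro h
    have := congrArg (coeff d₀) h
    rw [hp, coeff_weightedHomogeneousComponent, if_pos rfl] at this
    exact mem_support_iff.1 hd₀ this
  have hcoord : ∀ k, WeightLE (fun _ => 1) (φ.1.coord k) (ω k) := fun k =>
    weightLE_one_iff.2 le_rfl
  set f := fun k => homogeneousComponent (m k) (φ.1.coord k) with hf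
  have hmpos : ∀ k, 0 < m k := totalDegree_coord_pos φ
  have hf0 : ∀ k, f k ≠ 0 := fun k => homogeneousComponent_totalDegree_ne_zero fun h => by
    have := hmpos k
    simp [hm, h] at this
  -- The part of weight N of ψ_i(φ) = x_i is zero because N > 1.
  have hpf : bind₁ ![f 0, f 1] p = 0 := by
    have h := weightedHomogeneousComponent_bind₁ hcoord hLE
    rw [bind₁_coord_inv] at h
    simp only [hω, weightedHomogeneousComponent_one_eq] at h
    have hfe : ![f 0, f 1] = f := by ext1 k; fin_cases k <;> rfl
    rw [hfe]
    refine h.symm.trans ?_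
    refine weightedHomogeneousComponent_eq_zero' _ _ fun d hd hdN => ?_
    rw [support_X, Finset.mem_singleton] at hd
    rw [hd, weight_one_eq, Finsupp.degree_single] at hdN
    have : N = 1 := by rw [← hdN]; norm_num
    linarith
  -- Here deg φ_0 = b e and deg φ_1 = a e, so the a-th power of the first leading form and the b-th
  -- power of the second have equal degree.
  obtain ⟨e, b, a, he, hba, hm0, hm1⟩ := Nat.exists_coprime' (Nat.gcd_pos_of_pos_left (m 1) (hmpos 0))
  have ha : 1 ≤ a := Nat.pos_of_mul_pos_right (hm1 ▸ hmpos 1)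
  have hb : 1 ≤ b := Nat.pos_of_mul_pos_right (hm0 ▸ hmpos 0)
  have hwt : ∀ d : Fin 2 →₀ ℕ, Finsupp.weight ω d = ((d 0 * b + d 1 * a : ℕ) : ℚ) * e := fun d => by
    rw [Finsupp.weight_apply, Finsupp.sum_fintype _ _ (by simp), Fin.sum_univ_two]
    simp only [hω, hm0, hm1, nsmul_eq_mul]
    push_cast
    ring
  have hpM : ∀ d ∈ p.support, d 0 * b + d 1 * a = d₀ 0 * b + d₀ 1 * a := fun d hd => by
    have h := weightedHomogeneousComponent_isWeightedHomogeneous N (ψ i) (w := ω)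
      (mem_support_iff.1 hd)
    rw [hN, hwt, hwt] at h
    have he' : (e : ℚ) ≠ 0 := by exact_mod_cast he.ne'
    exact_mod_cast mul_right_cancel₀ he' h
  obtain ⟨c, hc, hfg, hdvd⟩ := exists_binomial_dvd ha hba.symm
    (by rw [mul_comm, ← hm0]; exact homogeneousComponent_isHomogeneous _ _)
    (by rw [mul_comm, ← hm1]; exact homogeneousComponent_isHomogeneous _ _)
    (hf0 0) (hf0 1) hp0 hpM hpf
  have hnot := not_two_le_of_deformation (lastZero_translationDeformation φ i)
    (exists_degreeOf_translationDeformation_ne_zero φ i)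
    (by rw [bind₁_translationDeformation, if_pos rfl, add_zero]) hLE hp0 hba.symm hc hdvd
  have key : ∀ i j : Fin 2, ∀ (c : K) (r : ℕ), m i = r * m j → f i = C c * f j ^ r →
      (φ.1.coord i - C c * φ.1.coord j ^ r).totalDegree < (φ.1.coord i).totalDegree := by
    intro i j c r hr hfr
    refine totalDegree_sub_lt (hmpos i) le_rfl ?_ ?_
    · refine (totalDegree_mul _ _).trans ?_
      rw [totalDegree_C, zero_add]
      exact (totalDegree_pow _ _).trans hr.ge
    · rw [homogeneousComponent_C_mul]
      refine hfr.trans ?_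
      rw [← homogeneousComponent_pow le_rfl r, ← hr]
  -- One of a, b is 1, so one leading form is a multiple of a power of the other and can be
  -- cancelled.
  by_cases ha2 : 2 ≤ a
  · have hb1 : b = 1 := by
      by_contra h
      exact hnot ⟨ha2, by omega⟩
    subst hb1
    refine ⟨1, 0, by decide, c⁻¹, a, key 1 0 _ _ (by rw [hm0, hm1, one_mul]) ?_⟩
    rw [hfg, pow_one, ← mul_assoc, ← C_mul, inv_mul_cancel₀ hc, C_1, one_mul]
  · have ha1 : a = 1 := by omega
    subst ha1
    refine ⟨0, 1, by decide, c, b, key 0 1 _ _ (by rw [hm0, hm1, one_mul]) ?_⟩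
    rw [← hfg, pow_one]

end AffineEnd

end

/-! ### The theorem of Jung and van der Kulk -/

section

open MvPolynomial

namespace AffineEnd

variable {K : Type*} [Field K] {n : ℕ}

theorem ext_fin_two {f g : AffineEnd K 2} (h0 : f.coord 0 = g.coord 0) (h1 : f.coord 1 = g.coord 1) :
    f = g := by
  ext1
  funext i
  fin_cases i
  · exact h0
  · exact h1

theorem degree_pos (φ : (AffineEnd K (n + 1))ˣ) : 1 ≤ φ.1.degree :=
  (totalDegree_coord_pos φ 0).trans_le (totalDegree_coord_le φ.1 0)

theorem degree_one_le : (1 : AffineEnd K n).degree ≤ 1 :=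
  Finset.sup_le fun i _ => by rw [coord_one, totalDegree_X]

variable (K n) in
/-- The affine automorphisms. -/
def affineSubmonoid : Submonoid (AffineEnd K n)ˣ where
  carrier := {φ | φ.1.degree ≤ 1}
  one_mem' := degree_one_le
  mul_mem' {φ ψ} hφ hψ := (degree_mul_le φ.1 ψ.1).trans (Nat.mul_le_mul hφ hψ)

theorem mem_affineSubmonoid {φ : (AffineEnd K n)ˣ} :
    φ ∈ affineSubmonoid K n ↔ φ.1.degree ≤ 1 := Iff.rfl

/-- Triangular endomorphisms `(a x + Q(y), b y + c)` of the plane with `deg Q ≤ d`. -/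
def IsTriangular (d : ℕ) (f : AffineEnd K 2) : Prop :=
  ∃ (a b c : K) (Q : Polynomial K), Q.natDegree ≤ d ∧
    f.coord 0 = C a * X 0 + Polynomial.aeval (X 1) Q ∧ f.coord 1 = C b * X 1 + C c

theorem isTriangular_one : IsTriangular 0 (1 : AffineEnd K 2) :=
  ⟨1, 1, 0, 0, by simp, by simp [coord_one], by simp [coord_one]⟩

theorem IsTriangular.mono {d e : ℕ} (h : d ≤ e) {f : AffineEnd K 2} (hf : IsTriangular d f) :
    IsTriangular e f := by
  obtain ⟨a, b, c, Q, hQ, h⟩ := hf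
  exact ⟨a, b, c, Q, hQ.trans ‹_›, h⟩

/-- The inner second coordinate has degree at most 1 in y, so composing Q with it does not raise its
degree. This uniform bound keeps the degrees of all twisted powers bounded. -/
theorem IsTriangular.mul {d : ℕ} {f g : AffineEnd K 2} (hf : IsTriangular d f)
    (hg : IsTriangular d g) : IsTriangular d (f * g) := by
  obtain ⟨a, b, c, Q, hQ, h0, h1⟩ := hf
  obtain ⟨a', b', c', Q', hQ', h0', h1'⟩ := hg
  refine ⟨a * a', b * b', b * c' + c, Polynomial.C a * Q' +
    Q.comp (Polynomial.C b' * Polynomial.X + Polynomial.C c'), ?_, ?_, ?_⟩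
  · refine (Polynomial.natDegree_add_le _ _).trans (max_le ?_ ?_)
    · exact (Polynomial.natDegree_C_mul_le _ _).trans hQ'
    · refine Polynomial.natDegree_comp_le.trans ?_
      exact (Nat.mul_le_mul hQ Polynomial.natDegree_linear_le).trans (mul_one d).le
  · rw [coord_mul, h0, map_add, map_mul, bind₁_C_right, bind₁_X_right, h0',
      ← Polynomial.aeval_algHom_apply, bind₁_X_right, h1', map_add,
      map_mul (Polynomial.aeval _), Polynomial.aeval_C, Polynomial.aeval_comp]
    simp only [map_add, map_mul, Polynomial.aeval_C, Polynomial.aeval_X, algebraMap_eq]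
    ring
  · rw [coord_mul, h1, map_add, map_mul, bind₁_C_right, bind₁_C_right, bind₁_X_right, h1']
    simp only [C_mul, C_add]
    ring

theorem totalDegree_aeval_X_le (Q : Polynomial K) (i : Fin n) :
    (Polynomial.aeval (X i : MvPolynomial (Fin n) K) Q).totalDegree ≤ Q.natDegree := by
  rw [Polynomial.aeval_eq_sum_range]
  refine totalDegree_finsetSum_le fun j hj => ?_
  refine (totalDegree_smul_le _ _).trans ?_
  rw [totalDegree_X_pow]
  exact Nat.lt_succ_iff.1 (Finset.mem_range.1 hj)

theorem totalDegree_linear_le (b c : K) (i : Fin n) :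
    (C b * X i + C c : MvPolynomial (Fin n) K).totalDegree ≤ 1 := by
  refine (totalDegree_add _ _).trans (max_le ?_ ?_)
  · refine (totalDegree_mul _ _).trans ?_
    rw [totalDegree_C, totalDegree_X]
  · rw [totalDegree_C]; exact Nat.zero_le _

theorem IsTriangular.degree_le {d : ℕ} {f : AffineEnd K 2} (hf : IsTriangular d f) :
    f.degree ≤ max d 1 := by
  obtain ⟨a, b, c, Q, hQ, h0, h1⟩ := hf
  refine Finset.sup_le fun i _ => ?_
  fin_cases i
  · change (f.coord 0).totalDegree ≤ _
    rw [h0]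
    refine (totalDegree_add _ _).trans (max_le ?_ ?_)
    · have := totalDegree_linear_le a 0 (0 : Fin 2)
      rw [C_0, add_zero] at this
      exact this.trans (le_max_right _ _)
    · exact (totalDegree_aeval_X_le Q 1).trans (hQ.trans (le_max_left _ _))
  · change (f.coord 1).totalDegree ≤ _
    rw [h1]
    exact (totalDegree_linear_le b c 1).trans (le_max_right _ _)

variable (K) in
/-- The triangular automorphisms of the plane. -/
def triangularSubmonoid : Submonoid (AffineEnd K 2)ˣ where
  carrier := {φ | ∃ d, IsTriangular d φ.1}
  one_mem' := ⟨0, isTriangular_one⟩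
  mul_mem' := by
    rintro φ ψ ⟨d, hd⟩ ⟨e, he⟩
    exact ⟨max d e, (hd.mono (le_max_left _ _)).mul (he.mono (le_max_right _ _))⟩

/-- The elementary automorphism `(x + Q(y), y)`. -/
noncomputable def elementary (Q : Polynomial K) : (AffineEnd K 2)ˣ where
  val := ⟨![X 0 + Polynomial.aeval (X 1) Q, X 1]⟩
  inv := ⟨![X 0 - Polynomial.aeval (X 1) Q, X 1]⟩
  val_inv := by
    refine ext_fin_two ?_ ?_ <;>
    simp [coord_mul, coord_one, ← Polynomial.aeval_algHom_apply]
  inv_val := by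
    refine ext_fin_two ?_ ?_ <;>
    simp [coord_mul, coord_one, ← Polynomial.aeval_algHom_apply]

variable (K) in
/-- The automorphism `(y, x)`. -/
noncomputable def swap : (AffineEnd K 2)ˣ where
  val := ⟨![X 1, X 0]⟩
  inv := ⟨![X 1, X 0]⟩
  val_inv := by refine ext_fin_two ?_ ?_ <;> simp [coord_mul, coord_one]
  inv_val := by refine ext_fin_two ?_ ?_ <;> simp [coord_mul, coord_one]

theorem elementary_inv_mem (Q : Polynomial K) : (elementary Q)⁻¹ ∈ triangularSubmonoid K :=
  ⟨_, 1, 1, 0, -Q, le_rfl, by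
    change X 0 - Polynomial.aeval (X 1) Q = _
    rw [map_neg, C_1, one_mul, sub_eq_add_neg], by
    change X 1 = _
    rw [C_1, C_0, one_mul, add_zero]⟩

theorem swap_inv_mem : (swap K)⁻¹ ∈ affineSubmonoid K 2 := by
  refine mem_affineSubmonoid.2 (Finset.sup_le fun i _ => ?_)
  fin_cases i
  · exact (totalDegree_X (R := K) (1 : Fin 2)).le
  · exact (totalDegree_X (R := K) (0 : Fin 2)).le

/-- Induction on the sum of the two coordinate degrees: a left factor (x - c y^e, y), preceded by
the swap if the second coordinate is the one to reduce, lowers the sum. -/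
theorem mem_closure_of_coord_sum_le (N : ℕ) : ∀ φ : (AffineEnd K 2)ˣ,
    (φ.1.coord 0).totalDegree + (φ.1.coord 1).totalDegree ≤ N →
    φ ∈ affineSubmonoid K 2 ⊔ triangularSubmonoid K := by
  induction N with
  | zero =>
    intro φ h
    have := totalDegree_coord_pos φ 0
    omega
  | succ N ih =>
    intro φ h
    by_cases hφ : φ.1.degree ≤ 1
    · exact Submonoid.mem_sup_left hφ
    obtain ⟨i, j, hij, c, e, hlt⟩ := exists_totalDegree_sub_lt φ (not_le.1 hφ)
    set θ := elementary (-(Polynomial.C c * Polynomial.X ^ e)) with hθ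
    have hθ' := Submonoid.mem_sup_right (S := affineSubmonoid K 2)
      (elementary_inv_mem (-(Polynomial.C c * Polynomial.X ^ e)))
    have hθ0 : ∀ ψ : (AffineEnd K 2)ˣ,
        (θ * ψ).1.coord 0 = ψ.1.coord 0 - C c * ψ.1.coord 1 ^ e := fun ψ => by
      change bind₁ ψ.1.coord (X 0 + Polynomial.aeval (X 1) (-(Polynomial.C c * Polynomial.X ^ e))) = _
      simp [sub_eq_add_neg]
    have hθ1 : ∀ ψ : (AffineEnd K 2)ˣ, (θ * ψ).1.coord 1 = ψ.1.coord 1 := fun ψ =>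
      bind₁_X_right _ _
    have hcase : (i = 0 ∧ j = 1) ∨ (i = 1 ∧ j = 0) := by omega
    rcases hcase with ⟨rfl, rfl⟩ | ⟨rfl, rfl⟩
    · have h2 := ih (θ * φ) (by rw [hθ0, hθ1]; omega)
      have := mul_mem hθ' h2
      rwa [← hθ, inv_mul_cancel_left] at this
    · have hs0 : (swap K * φ).1.coord 0 = φ.1.coord 1 := bind₁_X_right _ _
      have hs1 : (swap K * φ).1.coord 1 = φ.1.coord 0 := bind₁_X_right _ _
      have h2 := ih (θ * (swap K * φ)) (by rw [hθ0, hθ1, hs0, hs1]; omega)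
      have := mul_mem (Submonoid.mem_sup_left (T := triangularSubmonoid K) swap_inv_mem)
        (mul_mem hθ' h2)
      rwa [← hθ, inv_mul_cancel_left, inv_mul_cancel_left] at this

/-- The theorem of Jung and van der Kulk: every automorphism of the plane is a composition of affine
and triangular automorphisms. -/
theorem affine_sup_triangular_eq_top : affineSubmonoid K 2 ⊔ triangularSubmonoid K = ⊤ :=
  eq_top_iff.2 fun φ _ => mem_closure_of_coord_sum_le _ φ le_rfl

end AffineEnd

end

/-! ### Twisted conjugacy in a group generated by two submonoids -/

section

section TwistedConjugacy

variable {G : Type*} [Group G] {A B : Submonoid G}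

/-- Products of `n` elements of `B * A`. -/
def IsPairWord (A B : Submonoid G) (n : ℕ) (g : G) : Prop :=
  ∃ L : List (G × G), L.length = n ∧ (∀ x ∈ L, x.1 ∈ B ∧ x.2 ∈ A) ∧
    (L.map fun x => x.1 * x.2).prod = g

theorem exists_isPairWord (h : A ⊔ B = ⊤) (g : G) : ∃ n, IsPairWord A B n g := by
  have hg : g ∈ A ⊔ B := h ▸ Submonoid.mem_top g
  rw [Submonoid.sup_eq_closure] at hg
  induction hg using Submonoid.closure_induction with
  | one => exact ⟨0, [], rfl, by simp, rfl⟩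
  | mem g hg =>
    rcases hg with hg | hg
    · exact ⟨1, [(1, g)], rfl, by simpa using hg, by simp⟩
    · exact ⟨1, [(g, 1)], rfl, by simpa using hg, by simp⟩
  | mul g g' _ _ hg hg' =>
    obtain ⟨n, L, hL, hm, hp⟩ := hg
    obtain ⟨n', L', hL', hm', hp'⟩ := hg'
    refine ⟨n + n', L ++ L', by simp [hL, hL'], fun x hx => ?_, by simp [hp, hp']⟩
    rcases List.mem_append.1 hx with h | h
    · exact hm x h
    · exact hm' x h

/-- The semigroup generated by the products `b * a` with `b ∈ B \ A` and `a ∈ A \ B`. -/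
def alternatingSubsemigroup (A B : Submonoid G) : Subsemigroup G :=
  Subsemigroup.closure {g | ∃ b a, b ∈ B ∧ b ∉ A ∧ a ∈ A ∧ a ∉ B ∧ g = b * a}

theorem list_prod_mem_alternating : ∀ L : List (G × G), L ≠ [] →
    (∀ x ∈ L, (x.1 ∈ B ∧ x.2 ∈ A) ∧ x.1 ∉ A ∧ x.2 ∉ B) →
    (L.map fun x => x.1 * x.2).prod ∈ alternatingSubsemigroup A B := by
  intro L
  induction L with
  | nil => exact fun h => absurd rfl h
  | cons x L ih =>
    intro _ hL
    have hx := hL x (by simp)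
    have hmem : x.1 * x.2 ∈ alternatingSubsemigroup A B :=
      Subsemigroup.subset_closure ⟨_, _, hx.1.1, hx.2.1, hx.1.2, hx.2.2, rfl⟩
    by_cases h : L = []
    · subst h; simpa using hmem
    · rw [List.map_cons, List.prod_cons]
      exact mul_mem hmem (ih h fun y hy => hL y (by simp [hy]))

/-- Induction on the number of pairs. If a pair (b, a) has b in A or a in B, then b a lies in A or
in B. Twisted conjugation by the product of the letters to its right moves them to the front through
s and leaves b a last. There b a merges with a neighbouring letter, which shortens the word. If
there is no such pair, the word is already alternating. -/
theorem exists_twisted_conj_of_isPairWord (s : G →* G) (hA : ∀ a ∈ A, s a ∈ A)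
    (hB : ∀ b ∈ B, s b ∈ B) (n : ℕ) : ∀ g : G, IsPairWord A B n g →
    ∃ θ : G, s θ * g * θ⁻¹ ∈ A ∨ s θ * g * θ⁻¹ ∈ B ∨
      s θ * g * θ⁻¹ ∈ alternatingSubsemigroup A B := by
  induction n with
  | zero =>
    rintro g ⟨L, hL, -, rfl⟩
    rw [List.length_eq_zero_iff.1 hL]
    exact ⟨1, Or.inl (by simp)⟩
  | succ n ih =>
    rintro g ⟨L, hL, hm, rfl⟩
    by_cases hgood : ∀ x ∈ L, x.1 ∉ A ∧ x.2 ∉ B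
    · refine ⟨1, Or.inr (Or.inr ?_)⟩
      rw [map_one, one_mul, inv_one, mul_one]
      exact list_prod_mem_alternating L (by rintro rfl; simp at hL) fun x hx => ⟨hm x hx, hgood x hx⟩
    push Not at hgood
    obtain ⟨x, hx, hbad⟩ := hgood
    obtain ⟨U, V, rfl⟩ := List.append_of_mem hx
    have hmx := hm x hx
    set sV : List (G × G) := V.map fun y => (s y.1, s y.2) with hsV
    set W := sV ++ U with hW
    have hWm : ∀ y ∈ W, y.1 ∈ B ∧ y.2 ∈ A := by
      intro y hy
      rcases List.mem_append.1 hy with h | h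
      · obtain ⟨z, hz, rfl⟩ := List.mem_map.1 h
        have := hm z (by simp [hz])
        exact ⟨hB _ this.1, hA _ this.2⟩
      · exact hm y (by simp [h])
    have hWl : W.length = n := by
      simp only [List.length_append, List.length_cons] at hL
      simp only [hW, hsV, List.length_append, List.length_map]
      omega
    set v := (V.map fun x => x.1 * x.2).prod with hv
    set w := (W.map fun x => x.1 * x.2).prod with hw
    have hsv : (sV.map fun x => x.1 * x.2).prod = s v := by
      rw [hv, map_list_prod, hsV, List.map_map, List.map_map]
      congr 1
      refine List.map_congr_left fun y _ => ?_
      simp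
    have hconj : s v * ((U ++ x :: V).map fun x => x.1 * x.2).prod * v⁻¹ = w * (x.1 * x.2) := by
      rw [hw, hW, List.map_append, List.map_append, List.prod_append, List.prod_append, hsv,
        List.map_cons, List.prod_cons, ← hv]
      group
    have hcomp : ∀ θ g' : G, s v * ((U ++ x :: V).map fun x => x.1 * x.2).prod * v⁻¹ = g' →
        s (θ * v) * ((U ++ x :: V).map fun x => x.1 * x.2).prod * (θ * v)⁻¹ = s θ * g' * θ⁻¹ := by
      rintro θ g' rfl
      rw [map_mul]
      group
    rcases List.eq_nil_or_concat W with hWn | ⟨W', y, hWy⟩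
    · refine ⟨v, ?_⟩
      rw [hconj, hw, hWn, List.map_nil, List.prod_nil, one_mul]
      -- No neighbour is left: the twisted conjugate is the single product b a.
      by_cases h1 : x.1 ∈ A
      · exact Or.inl (mul_mem h1 hmx.2)
      · exact Or.inr (Or.inl (mul_mem hmx.1 (hbad h1)))
    · by_cases h1 : x.1 ∈ A
      · have hpw : IsPairWord A B n (w * (x.1 * x.2)) := by
          refine ⟨W' ++ [(y.1, y.2 * (x.1 * x.2))], ?_, ?_, ?_⟩
          · rw [← hWl, hWy]; simp
          · intro z hz
            rcases List.mem_append.1 hz with h | h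
            · exact hWm z (by simp [hWy, h])
            · rw [List.mem_singleton.1 h]
              have := hWm y (by simp [hWy])
              exact ⟨this.1, mul_mem this.2 (mul_mem h1 hmx.2)⟩
          · rw [hw, hWy]; simp [mul_assoc]
        obtain ⟨θ, hθ⟩ := ih _ hpw
        exact ⟨θ * v, by rwa [hcomp θ _ hconj]⟩
      · have hxB := mul_mem hmx.1 (hbad h1)
        cases hWc : W with
        | nil => simp [hWc] at hWy
        | cons z W'' =>
          have hz := hWm z (by simp [hWc])
          -- If b a lies in B, a further twisted conjugation moves it to the front as s(b a), where
          -- the first letter, in B, absorbs it.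
          have hpw : IsPairWord A B n (s (x.1 * x.2) * w) := by
            refine ⟨(s (x.1 * x.2) * z.1, z.2) :: W'', ?_, ?_, ?_⟩
            · rw [← hWl, hWc]; simp
            · intro t ht
              rcases List.mem_cons.1 ht with h | h
              · rw [h]
                exact ⟨mul_mem (hB _ hxB) hz.1, hz.2⟩
              · exact hWm t (by simp [hWc, h])
            · rw [hw, hWc]; simp [mul_assoc]
          obtain ⟨θ, hθ⟩ := ih _ hpw
          refine ⟨θ * (x.1 * x.2) * v, ?_⟩
          rw [hcomp _ _ hconj]
          have : s (θ * (x.1 * x.2)) * (w * (x.1 * x.2)) * (θ * (x.1 * x.2))⁻¹ =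
              s θ * (s (x.1 * x.2) * w) * θ⁻¹ := by
            rw [map_mul s θ]
            group
          rwa [this]

/-- Every element of a group generated by two submonoids is twisted-conjugate to an element of one
of them or to an alternating product. -/
theorem exists_twisted_conj (h : A ⊔ B = ⊤) (s : G →* G) (hA : ∀ a ∈ A, s a ∈ A)
    (hB : ∀ b ∈ B, s b ∈ B) (g : G) :
    ∃ θ : G, s θ * g * θ⁻¹ ∈ A ∨ s θ * g * θ⁻¹ ∈ B ∨
      s θ * g * θ⁻¹ ∈ alternatingSubsemigroup A B := by
  obtain ⟨n, hn⟩ := exists_isPairWord h g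
  exact exists_twisted_conj_of_isPairWord s hA hB n g hn

end TwistedConjugacy

end

/-! ### Growth rates, twisted powers and dominant leading parts -/

section

open MvPolynomial Filter Topology

section RootGrowth

theorem tendsto_const_rpow_one_div {C : ℝ} (hC : 0 < C) :
    Tendsto (fun r : ℕ => C ^ (1 / (r : ℝ))) atTop (𝓝 1) := by
  have h := (Real.continuousAt_const_rpow (b := 0) hC.ne').tendsto.comp
    (tendsto_one_div_atTop_nhds_zero_nat (𝕜 := ℝ))
  rw [Real.rpow_zero] at h
  exact h

/-- The r-th root of a fixed positive constant tends to 1, so growth rates ignore bounded factors.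
-/
theorem tendsto_root_of_le_mul {u v : ℕ → ℕ} {C L : ℝ} (hC : 0 < C) (huv : ∀ r, (u r : ℝ) ≤ C * v r)
    (hvu : ∀ r, (v r : ℝ) ≤ C * u r)
    (hu : Tendsto (fun r : ℕ => (u r : ℝ) ^ (1 / (r : ℝ))) atTop (𝓝 L)) :
    Tendsto (fun r : ℕ => (v r : ℝ) ^ (1 / (r : ℝ))) atTop (𝓝 L) := by
  have h1 := (tendsto_const_rpow_one_div (inv_pos.2 hC)).mul hu
  have h2 := (tendsto_const_rpow_one_div hC).mul hu
  rw [one_mul] at h1 h2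
  refine tendsto_of_tendsto_of_tendsto_of_le_of_le h1 h2 (fun r => ?_) (fun r => ?_)
  · change C⁻¹ ^ (1 / (r : ℝ)) * (u r : ℝ) ^ (1 / (r : ℝ)) ≤ (v r : ℝ) ^ (1 / (r : ℝ))
    rw [← Real.mul_rpow (inv_pos.2 hC).le (Nat.cast_nonneg _)]
    refine Real.rpow_le_rpow (by positivity) ?_ (by positivity)
    rw [inv_mul_le_iff₀ hC]
    exact huv r
  · change (v r : ℝ) ^ (1 / (r : ℝ)) ≤ C ^ (1 / (r : ℝ)) * (u r : ℝ) ^ (1 / (r : ℝ))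
    rw [← Real.mul_rpow hC.le (Nat.cast_nonneg _)]
    exact Real.rpow_le_rpow (by positivity) (hvu r) (by positivity)

theorem tendsto_root_of_bounded {u : ℕ → ℕ} {C : ℕ} (h1 : ∀ r, 1 ≤ u r) (hC : ∀ r, u r ≤ C) :
    Tendsto (fun r : ℕ => (u r : ℝ) ^ (1 / (r : ℝ))) atTop (𝓝 1) := by
  have hC0 : (0 : ℝ) < C := by exact_mod_cast (h1 0).trans (hC 0)
  refine tendsto_root_of_le_mul (u := fun _ => 1) hC0 (fun r => ?_) (fun r => ?_) (by simp)
  · have : 1 * 1 ≤ C * u r := Nat.mul_le_mul ((h1 0).trans (hC 0)) (h1 r)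
    exact_mod_cast this
  · simpa using hC r

theorem tendsto_root_pow (D : ℕ) :
    Tendsto (fun r : ℕ => ((D ^ r : ℕ) : ℝ) ^ (1 / (r : ℝ))) atTop (𝓝 D) := by
  refine tendsto_const_nhds.congr' ?_
  filter_upwards [eventually_ge_atTop 1] with r hr
  rw [Nat.cast_pow, one_div, Real.pow_rpow_inv_natCast (Nat.cast_nonneg _) (by omega)]

end RootGrowth

/-- The twisted powers `sʳ⁻¹(h) ⋯ s(h) h`. -/
def twistedPow {M : Type*} [Monoid M] (s : M →* M) (h : M) : ℕ → M
  | 0 => 1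
  | r + 1 => s (twistedPow s h r) * h

theorem twistedPow_mem {M : Type*} [Monoid M] {s : M →* M} {S : Subsemigroup M}
    (hs : ∀ x ∈ S, s x ∈ S) {h : M} (hh : h ∈ S) (r : ℕ) : twistedPow s h (r + 1) ∈ S := by
  induction r with
  | zero => simpa [twistedPow] using hh
  | succ r ih => exact mul_mem (hs _ ih) hh

/-- The intermediate factors telescope. As s preserves degrees in the application, the two outer
factors change the degree by a bounded ratio only. -/
theorem twistedPow_conj {G : Type*} [Group G] (s : G →* G) (θ g : G) (r : ℕ) :
    twistedPow s (s θ * g * θ⁻¹) r = s^[r] θ * twistedPow s g r * θ⁻¹ := by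
  induction r with
  | zero => simp [twistedPow]
  | succ r ih =>
    rw [twistedPow, ih, twistedPow, Function.iterate_succ_apply', map_mul, map_mul, map_inv]
    group

theorem map_twistedPow {M N : Type*} [Monoid M] [Monoid N] (f : M →* N) {s : M →* M} {t : N →* N}
    (hst : ∀ x, f (s x) = t (f x)) (h : M) (r : ℕ) :
    f (twistedPow s h r) = twistedPow t (f h) r := by
  induction r with
  | zero => exact map_one f
  | succ r ih => rw [twistedPow, twistedPow, map_mul, hst, ih]

namespace AffineEnd

variable {K : Type*} [Field K] {n : ℕ}

variable (n) in
/-- The action of a field homomorphism on the coefficients of an endomorphism. -/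
noncomputable def mapCoeff {L : Type*} [Field L] (σ : K →+* L) : AffineEnd K n →* AffineEnd L n where
  toFun f := ⟨fun i => map σ (f.coord i)⟩
  map_one' := by
    ext1; funext i
    exact map_X σ i
  map_mul' f g := by
    ext1; funext i
    exact map_bind₁ σ g.coord (f.coord i)

theorem coord_mapCoeff {L : Type*} [Field L] (σ : K →+* L) (f : AffineEnd K n) (i : Fin n) :
    (mapCoeff n σ f).coord i = map σ (f.coord i) := rfl

theorem degree_mapCoeff {L : Type*} [Field L] (σ : K →+* L) (f : AffineEnd K n) :
    (mapCoeff n σ f).degree = f.degree :=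
  Finset.sup_congr rfl fun i _ => by
    rw [coord_mapCoeff, totalDegree, totalDegree, support_map_of_injective _ σ.injective]

theorem IsTriangular.mapCoeff (σ : K →+* K) {d : ℕ} {f : AffineEnd K 2} (hf : IsTriangular d f) :
    IsTriangular d (mapCoeff 2 σ f) := by
  obtain ⟨a, b, c, Q, hQ, h0, h1⟩ := hf
  refine ⟨σ a, σ b, σ c, Q.map σ, (Polynomial.natDegree_map_le).trans hQ, ?_, ?_⟩
  · rw [coord_mapCoeff, h0, map_add, map_mul, map_C, map_X]
    congr 1
    rw [Polynomial.aeval_def, Polynomial.aeval_def, Polynomial.hom_eval₂, Polynomial.eval₂_map, map_X]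
    congr 1
    ext1 x
    simp
  · rw [coord_mapCoeff, h1, map_add, map_mul, map_C, map_X, map_C]

/-- The part of degree `D` of `f` is of the form `(H, 0)` with `H (1, 0) ≠ 0`, and `f` has no
parts of higher degree. -/
structure IsDominant (D : ℕ) (f : AffineEnd K 2) : Prop where
  pos : 0 < D
  totalDegree_le : ∀ i, (f.coord i).totalDegree ≤ D
  eval_ne_zero : eval ![1, 0] (homogeneousComponent D (f.coord 0)) ≠ 0
  component_eq_zero : homogeneousComponent D (f.coord 1) = 0

theorem IsDominant.degree_eq {D : ℕ} {f : AffineEnd K 2} (hf : IsDominant D f) : f.degree = D := by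
  refine le_antisymm (Finset.sup_le fun i _ => hf.totalDegree_le i) ?_
  by_contra h
  refine hf.eval_ne_zero ?_
  rw [homogeneousComponent_eq_zero _ _ ((totalDegree_coord_le f 0).trans_lt (not_le.1 h)), map_zero]

theorem eval_smul_of_isHomogeneous {σ : Type*} {p : MvPolynomial σ K} {D : ℕ}
    (hp : p.IsHomogeneous D) (t : K) (x : σ → K) : eval (t • x) p = t ^ D * eval x p := by
  rw [eval_eq, eval_eq, Finset.mul_sum]
  refine Finset.sum_congr rfl fun d hd => ?_
  simp only [Pi.smul_apply, smul_eq_mul, mul_pow, Finset.prod_mul_distrib]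
  rw [Finset.prod_pow_eq_pow_sum, ← hp.degree_eq_sum_deg_support hd]
  ring

theorem homogeneousComponent_bind₁ {σ τ : Type*} {F : σ → MvPolynomial τ K} {p : MvPolynomial σ K}
    {D E : ℕ} (hE : 0 < E) (hF : ∀ i, (F i).totalDegree ≤ E) (hp : p.totalDegree ≤ D) :
    homogeneousComponent (D * E) (bind₁ F p) =
      bind₁ (fun i => homogeneousComponent E (F i)) (homogeneousComponent D p) := by
  classical
  have hw : ∀ d : σ →₀ ℕ, Finsupp.weight (fun _ => (E : ℚ)) d = (d.degree : ℚ) * E := fun d => by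
    rw [Finsupp.weight_apply, Finsupp.sum, Finsupp.degree_apply, Nat.cast_sum, Finset.sum_mul]
    simp
  have hp' : WeightLE (fun _ : σ => (E : ℚ)) p (D * E : ℕ) := fun d hd => by
    rw [hw]
    exact_mod_cast Nat.mul_le_mul_right E ((le_totalDegree hd).trans hp)
  have h := weightedHomogeneousComponent_bind₁ (w := fun _ => (E : ℚ)) (w' := fun _ => 1) (F := F)
    (fun i => weightLE_one_iff.2 (hF i)) hp'
  simp only [weightedHomogeneousComponent_one_eq] at h
  rw [h]
  congr 1
  ext d
  rw [coeff_weightedHomogeneousComponent, coeff_homogeneousComponent, hw]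
  have hE' : (E : ℚ) ≠ 0 := by exact_mod_cast hE.ne'
  simp only [Nat.cast_mul, mul_left_inj' hE', Nat.cast_inj]

/-- The leading part of g sends (1, 0) to t (1, 0) with t ≠ 0, and by homogeneity the leading form
of f takes there t^D times its nonzero value at (1, 0). So the top parts do not cancel in the
composition. -/
theorem IsDominant.mul {D E : ℕ} {f g : AffineEnd K 2} (hf : IsDominant D f)
    (hg : IsDominant E g) : IsDominant (D * E) (f * g) := by
  have hcomp : ∀ i, homogeneousComponent (D * E) ((f * g).coord i) =
      bind₁ (fun i => homogeneousComponent E (g.coord i)) (homogeneousComponent D (f.coord i)) :=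
    fun i => homogeneousComponent_bind₁ hg.pos hg.totalDegree_le (hf.totalDegree_le i)
  refine ⟨Nat.mul_pos hf.pos hg.pos, fun i => ?_, ?_, ?_⟩
  · refine (totalDegree_coord_le _ i).trans ((degree_mul_le f g).trans ?_)
    rw [hf.degree_eq, hg.degree_eq]
  · rw [hcomp, eval, eval₂Hom_bind₁]
    change eval (fun i => eval ![1, 0] (homogeneousComponent E (g.coord i))) _ ≠ 0
    have : (fun i => eval ![1, 0] (homogeneousComponent E (g.coord i))) =
        eval ![1, 0] (homogeneousComponent E (g.coord 0)) • ![1, 0] := by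
      ext1 i
      fin_cases i
      · simp
      · simp [hg.component_eq_zero]
    rw [this, eval_smul_of_isHomogeneous (homogeneousComponent_isHomogeneous _ _)]
    exact mul_ne_zero (pow_ne_zero _ hg.eval_ne_zero) hf.eval_ne_zero
  · rw [hcomp, hf.component_eq_zero, map_zero]

theorem homogeneousComponent_map {σ L : Type*} [Field L] (φ : K →+* L) (p : MvPolynomial σ K)
    (D : ℕ) : homogeneousComponent D (map φ p) = map φ (homogeneousComponent D p) := by
  classical
  ext d
  rw [coeff_homogeneousComponent, coeff_map, coeff_map, coeff_homogeneousComponent]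
  split_ifs <;> simp

theorem IsDominant.mapCoeff (σ : K →+* K) {D : ℕ} {f : AffineEnd K 2} (hf : IsDominant D f) :
    IsDominant D (mapCoeff 2 σ f) := by
  refine ⟨hf.pos, fun i => ?_, ?_, ?_⟩
  · rw [← hf.degree_eq, ← degree_mapCoeff σ]
    exact totalDegree_coord_le _ i
  · rw [coord_mapCoeff, homogeneousComponent_map, eval_map]
    have h := eval₂_comp_left σ (RingHom.id K) ![1, 0] (homogeneousComponent D (f.coord 0))
    have h2 : σ ∘ ![1, 0] = ![1, 0] := by
      ext1 i; fin_cases i <;> simp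
    rw [h2, RingHom.comp_id] at h
    rw [← h]
    exact (map_ne_zero σ).2 hf.eval_ne_zero
  · rw [coord_mapCoeff, homogeneousComponent_map, hf.component_eq_zero, map_zero]

end AffineEnd

end

/-! ### Integral growth for semilinear automorphisms of the plane -/

section

open MvPolynomial Filter Topology

namespace AffineEnd

variable {K : Type*} [Field K]

theorem eq_linear_of_totalDegree_le_one {p : MvPolynomial (Fin 2) K} (hp : p.totalDegree ≤ 1) :
    p = C (coeff (Finsupp.single 0 1) p) * X 0 + C (coeff (Finsupp.single 1 1) p) * X 1 +
      C (coeff 0 p) := by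
  classical
  ext d
  simp only [coeff_add, coeff_C_mul, coeff_X, coeff_C]
  by_cases hd : d.degree ≤ 1
  · rw [Finsupp.degree_eq_sum, Fin.sum_univ_two] at hd
    have hcase : (d 0 = 0 ∧ d 1 = 0) ∨ (d 0 = 1 ∧ d 1 = 0) ∨ (d 0 = 0 ∧ d 1 = 1) := by omega
    have hext : ∀ e : Fin 2 →₀ ℕ, e = d ↔ e 0 = d 0 ∧ e 1 = d 1 := fun e => by
      rw [Finsupp.ext_iff, Fin.forall_fin_two]
    rcases hcase with ⟨h0, h1⟩ | ⟨h0, h1⟩ | ⟨h0, h1⟩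
    · have : d = 0 := ((hext 0).2 (by simp [h0, h1])).symm
      simp [this]
    · have : d = Finsupp.single 0 1 := ((hext _).2 (by simp [h0, h1])).symm
      simp [hext, h0, h1, ← this]
    · have : d = Finsupp.single 1 1 := ((hext _).2 (by simp [h0, h1])).symm
      simp [hext, h0, h1, ← this]
  · have h1 : coeff d p = 0 := by
      by_contra h
      exact hd ((le_totalDegree (mem_support_iff.2 h)).trans hp)
    have h2 : ∀ i : Fin 2, Finsupp.single i 1 ≠ d := by
      rintro i rfl; simp at hd
    have h3 : 0 ≠ d := by rintro rfl; simp at hd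
    simp [h1, h2, h3]

/-- The value is the coefficient of x in the second coordinate; if it vanished, the affine map would
be triangular. -/
theorem eval_component_one_ne_zero {φ : (AffineEnd K 2)ˣ} (hφ : φ ∈ affineSubmonoid K 2)
    (hφ' : φ ∉ triangularSubmonoid K) :
    eval ![1, 0] (homogeneousComponent 1 (φ.1.coord 1)) ≠ 0 := by
  have hdeg := fun i => (totalDegree_coord_le φ.1 i).trans hφ
  have h0 := eq_linear_of_totalDegree_le_one (hdeg 0)
  have h1 := eq_linear_of_totalDegree_le_one (hdeg 1)
  intro h
  have hc : ∀ (i : Fin 2) (c : K), homogeneousComponent 1 (C c * X i : MvPolynomial (Fin 2) K) =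
      C c * X i := fun i c => homogeneousComponent_eq_self (isHomogeneous_C_mul_X c i)
  have hc0 : homogeneousComponent 1 (C (coeff 0 (φ.1.coord 1)) : MvPolynomial (Fin 2) K) = 0 :=
    homogeneousComponent_eq_zero _ _ (by rw [totalDegree_C]; exact one_pos)
  rw [h1, map_add (homogeneousComponent 1), map_add (homogeneousComponent 1), hc, hc, hc0] at h
  simp only [map_add, map_mul, eval_C, eval_X, Matrix.cons_val, mul_one, mul_zero,
    add_zero] at h
  refine hφ' ⟨_, coeff (Finsupp.single 0 1) (φ.1.coord 0), coeff (Finsupp.single 1 1) (φ.1.coord 1),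
    coeff 0 (φ.1.coord 1), Polynomial.C (coeff (Finsupp.single 1 1) (φ.1.coord 0)) * Polynomial.X +
      Polynomial.C (coeff 0 (φ.1.coord 0)), le_rfl, ?_, ?_⟩
  · conv_lhs => rw [h0]
    simp only [map_add, map_mul, Polynomial.aeval_C, Polynomial.aeval_X, algebraMap_eq, add_assoc]
  · conv_lhs => rw [h1]
    rw [h, C_0, zero_mul, zero_add]

/-- With D = deg Q ≥ 2, the leading part of the first coordinate is the leading coefficient of Q
times the D-th power of the linear part of φ_1, which is nonzero at (1, 0). The other terms and the
second coordinate have degree less than D. -/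
theorem exists_isDominant_mul {ψ φ : (AffineEnd K 2)ˣ} (hψ : ψ ∈ triangularSubmonoid K)
    (hψ' : ψ ∉ affineSubmonoid K 2) (hφ : φ ∈ affineSubmonoid K 2)
    (hφ' : φ ∉ triangularSubmonoid K) : ∃ D, IsDominant D (ψ * φ).1 := by
  obtain ⟨d, a, b, c, Q, hQ, h0, h1⟩ := hψ
  have hψd : ψ.1.degree ≤ max Q.natDegree 1 :=
    IsTriangular.degree_le ⟨a, b, c, Q, le_rfl, h0, h1⟩
  set D := Q.natDegree with hD
  have hD2 : 2 ≤ D := by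
    have : ¬ ψ.1.degree ≤ 1 := hψ'
    omega
  have hdeg := fun i => (totalDegree_coord_le φ.1 i).trans (mem_affineSubmonoid.1 hφ)
  have hlin : ∀ (i : Fin 2) (c : K), (C c * φ.1.coord i).totalDegree ≤ 1 := fun i c => by
    refine (totalDegree_mul _ _).trans ?_
    rw [totalDegree_C, zero_add]
    exact hdeg i
  have hcoord0 : (ψ * φ).1.coord 0 = C a * φ.1.coord 0 + Polynomial.aeval (φ.1.coord 1) Q := by
    rw [Units.val_mul, coord_mul, h0, map_add, map_mul, bind₁_C_right, bind₁_X_right,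
      ← Polynomial.aeval_algHom_apply, bind₁_X_right]
  have hcoord1 : (ψ * φ).1.coord 1 = C b * φ.1.coord 1 + C c := by
    rw [Units.val_mul, coord_mul, h1, map_add, map_mul, bind₁_C_right, bind₁_C_right, bind₁_X_right]
  refine ⟨D, by omega, fun i => ?_, ?_, ?_⟩
  · refine (totalDegree_coord_le _ i).trans ((degree_mul_le ψ.1 φ.1).trans ?_)
    refine (Nat.mul_le_mul hψd hφ).trans ?_
    omega
  · have hpow : ∀ j, (φ.1.coord 1 ^ j).totalDegree ≤ j := fun j =>
      (totalDegree_pow _ _).trans ((Nat.mul_le_mul_left j (hdeg 1)).trans (mul_one j).le)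
    have h2 : homogeneousComponent D (Polynomial.aeval (φ.1.coord 1) Q) =
        C Q.leadingCoeff * homogeneousComponent 1 (φ.1.coord 1) ^ D := by
      rw [Polynomial.aeval_eq_sum_range, map_sum, Finset.sum_eq_single D]
      · have h3 := homogeneousComponent_pow (hdeg 1) D
        rw [mul_one] at h3
        rw [map_smul, h3, smul_eq_C_mul]
        rfl
      · intro j hj hjD
        rw [map_smul, homogeneousComponent_eq_zero, smul_zero]
        have := Finset.mem_range.1 hj
        exact (hpow j).trans_lt (by omega)
      · exact fun h => absurd (Finset.mem_range.2 (Nat.lt_succ_self _)) h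
    rw [hcoord0, map_add, homogeneousComponent_eq_zero _ _ ((hlin 0 a).trans_lt hD2), zero_add, h2,
      map_mul, eval_C, map_pow]
    refine mul_ne_zero ?_ (pow_ne_zero _ (eval_component_one_ne_zero hφ hφ'))
    rw [Ne, Polynomial.leadingCoeff_eq_zero]
    rintro rfl
    simp at hD
    omega
  · rw [hcoord1]
    refine homogeneousComponent_eq_zero _ _ (lt_of_le_of_lt ?_ hD2)
    refine (totalDegree_add _ _).trans (max_le (hlin 1 b) ?_)
    rw [totalDegree_C]
    exact Nat.zero_le _

theorem exists_isDominant_of_mem {φ : (AffineEnd K 2)ˣ}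
    (hφ : φ ∈ alternatingSubsemigroup (affineSubmonoid K 2) (triangularSubmonoid K)) :
    ∃ D, IsDominant D φ.1 := by
  induction hφ using Subsemigroup.closure_induction with
  | mem g hg =>
    obtain ⟨b, a, hb, hb', ha, ha', rfl⟩ := hg
    exact exists_isDominant_mul hb hb' ha ha'
  | mul g g' _ _ h h' =>
    obtain ⟨D, hD⟩ := h
    obtain ⟨E, hE⟩ := h'
    exact ⟨D * E, hD.mul hE⟩

theorem isDominant_twistedPow (σ : K →+* K) {D : ℕ} {h : AffineEnd K 2} (hh : IsDominant D h)
    (r : ℕ) : IsDominant (D ^ (r + 1)) (twistedPow (mapCoeff 2 σ) h (r + 1)) := by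
  induction r with
  | zero => simpa [twistedPow] using hh
  | succ r ih => exact (ih.mapCoeff σ).mul hh

/-- The degrees of the iterates of a semilinear automorphism of the plane have integral growth
rate. -/
theorem exists_tendsto_degree_twistedPow (σ : K →+* K) (h : (AffineEnd K 2)ˣ) :
    ∃ d : ℕ, Tendsto (fun r : ℕ => ((twistedPow (mapCoeff 2 σ) h.1 r).degree : ℝ) ^ (1 / (r : ℝ)))
      atTop (𝓝 (d : ℝ)) := by
  set s : (AffineEnd K 2)ˣ →* (AffineEnd K 2)ˣ := Units.map (mapCoeff 2 σ) with hs
  have hsdeg : ∀ φ, (s φ).1.degree = φ.1.degree := fun φ => degree_mapCoeff σ φ.1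
  have hval : ∀ (g : (AffineEnd K 2)ˣ) r,
      (twistedPow s g r).1 = twistedPow (mapCoeff 2 σ) g.1 r := fun g r =>
    map_twistedPow (Units.coeHom _) (fun _ => rfl) g r
  have hsA : ∀ a ∈ affineSubmonoid K 2, s a ∈ affineSubmonoid K 2 := fun a ha =>
    (hsdeg a).le.trans ha
  have hsB : ∀ b ∈ triangularSubmonoid K, s b ∈ triangularSubmonoid K := by
    rintro b ⟨d, hd⟩
    exact ⟨d, hd.mapCoeff σ⟩
  obtain ⟨θ, hθ⟩ := exists_twisted_conj affine_sup_triangular_eq_top s hsA hsB h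
  set g := s θ * h * θ⁻¹ with hg
  have hgoal : ∃ d : ℕ, Tendsto (fun r : ℕ => ((twistedPow s g r).1.degree : ℝ) ^ (1 / (r : ℝ)))
      atTop (𝓝 (d : ℝ)) := by
    rcases hθ with hA | hB | hT
    · refine ⟨1, ?_⟩
      rw [Nat.cast_one]
      refine tendsto_root_of_bounded (C := 1) (fun r => degree_pos _) fun r => ?_
      cases r with
      | zero => exact degree_one_le
      | succ r => exact twistedPow_mem (S := (affineSubmonoid K 2).toSubsemigroup) hsA hA r
    · obtain ⟨d, hd⟩ := hB
      refine ⟨1, ?_⟩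
      rw [Nat.cast_one]
      refine tendsto_root_of_bounded (C := max d 1) (fun r => degree_pos _) fun r => ?_
      rw [hval]
      refine IsTriangular.degree_le ?_
      induction r with
      | zero => exact isTriangular_one.mono (Nat.zero_le d)
      | succ r ih => exact (ih.mapCoeff σ).mul hd
    · obtain ⟨D, hD⟩ := exists_isDominant_of_mem hT
      refine ⟨D, (tendsto_root_pow D).congr' ?_⟩
      filter_upwards [eventually_ge_atTop 1] with r hr
      obtain ⟨r, rfl⟩ := Nat.exists_eq_add_of_le' hr
      rw [hval, (isDominant_twistedPow σ hD r).degree_eq]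
  obtain ⟨d, hd⟩ := hgoal
  refine ⟨d, ?_⟩
  have hiter : ∀ (φ : (AffineEnd K 2)ˣ) r, (s^[r] φ).1.degree = φ.1.degree := fun φ r => by
    induction r with
    | zero => rfl
    | succ r ih => rw [Function.iterate_succ_apply', hsdeg, ih]
  have hiter' : ∀ r, (s^[r] θ)⁻¹ = s^[r] θ⁻¹ := fun r => (iterate_map_inv s r θ).symm
  have hprod : ∀ α β γ : (AffineEnd K 2)ˣ,
      (α * β * γ).1.degree ≤ α.1.degree * γ.1.degree * β.1.degree := fun α β γ => by
    have h1 := degree_mul_le (α * β).1 γ.1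
    have h2 := degree_mul_le α.1 β.1
    calc (α * β * γ).1.degree ≤ (α * β).1.degree * γ.1.degree := h1
      _ ≤ α.1.degree * β.1.degree * γ.1.degree := Nat.mul_le_mul_right _ h2
      _ = _ := by ring
  -- The untwisted and the conjugated powers differ by outer factors of degrees deg θ and deg θ⁻¹,
  -- so this product bounds the ratio of degrees both ways.
  have hC : (0 : ℝ) < (θ.1.degree * (θ⁻¹).1.degree : ℕ) := by
    exact_mod_cast Nat.mul_pos (degree_pos θ) (degree_pos θ⁻¹)
  refine tendsto_root_of_le_mul (u := fun r => (twistedPow s g r).1.degree) hC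
    (fun r => ?_) (fun r => ?_) hd
  · rw [← hval, hg, twistedPow_conj]
    have := hprod (s^[r] θ) (twistedPow s h r) θ⁻¹
    rw [hiter] at this
    exact_mod_cast this
  · rw [← hval]
    have := hprod (s^[r] θ)⁻¹ (twistedPow s g r) θ
    rw [hiter', hiter, ← hiter', hg, twistedPow_conj] at this
    rw [hg, twistedPow_conj]
    have h2 : (s^[r] θ)⁻¹ * (s^[r] θ * twistedPow s h r * θ⁻¹) * θ = twistedPow s h r := by group
    rw [h2, mul_comm (θ⁻¹).1.degree] at this
    exact_mod_cast this

/-- The dynamical degree of an automorphism of the plane is an integer. -/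
theorem exists_dynamicalDegree_eq_natCast (f : (AffineEnd K 2)ˣ) :
    ∃ d : ℕ, f.1.dynamicalDegree = d := by
  obtain ⟨d, hd⟩ := exists_tendsto_degree_twistedPow (RingHom.id K) f
  refine ⟨d, tendsto_nhds_unique (tendsto_dynamicalDegree f.1) (hd.congr fun r => ?_)⟩
  congr 3
  induction r with
  | zero => rfl
  | succ r ih =>
    rw [twistedPow, ih, pow_succ]
    congr 1
    ext1; funext i
    exact map_id _

end AffineEnd

end

/-! ### Skew products and their generic fibres -/

section

open MvPolynomial

namespace AffineEnd

variable {k : Type*} [Field k] {m c : ℕ}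

theorem totalDegree_aeval_le {σ τ S : Type*} [CommRing S] [Algebra k S] {F : σ → MvPolynomial τ S}
    (hF : ∀ i, (F i).totalDegree ≤ 1) (p : MvPolynomial σ k) :
    (aeval F p).totalDegree ≤ p.totalDegree := by
  rw [aeval_def, eval₂_eq]
  refine totalDegree_finsetSum_le fun d hd => ?_
  refine (totalDegree_mul _ _).trans ?_
  rw [MvPolynomial.algebraMap_apply, totalDegree_C, zero_add]
  refine (totalDegree_finsetProd _ _).trans ((Finset.sum_le_sum fun i _ => ?_).trans
    (le_totalDegree hd))
  exact (totalDegree_pow _ _).trans ((Nat.mul_le_mul_left _ (hF i)).trans (mul_one _).le)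

variable (k m c) in
/-- Polynomials in `m + c` variables as polynomials in the last `c` variables. -/
noncomputable def splitVars :
    MvPolynomial (Fin (m + c)) k →ₐ[k] MvPolynomial (Fin c) (MvPolynomial (Fin m) k) :=
  aeval (Fin.append (fun i => C (X i)) X)

theorem splitVars_X_castAdd (i : Fin m) : splitVars k m c (X (Fin.castAdd c i)) = C (X i) := by
  rw [splitVars, aeval_X, Fin.append_left]

theorem splitVars_X_natAdd (j : Fin c) : splitVars k m c (X (Fin.natAdd m j)) = X j := by
  rw [splitVars, aeval_X, Fin.append_right]

theorem splitVars_rename (p : MvPolynomial (Fin m) k) :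
    splitVars k m c (rename (Fin.castAdd c) p) = C p := by
  induction p using MvPolynomial.induction_on with
  | C a =>
    rw [rename_C, ← algebraMap_eq, AlgHom.commutes]
    rfl
  | add p q hp hq => rw [map_add, map_add, hp, hq, C_add]
  | mul_X p i hp => rw [map_mul, map_mul, hp, rename_X, splitVars_X_castAdd, C_mul]

variable (k m c) in
/-- The inverse of `splitVars`. -/
noncomputable def mergeVars :
    MvPolynomial (Fin c) (MvPolynomial (Fin m) k) →+* MvPolynomial (Fin (m + c)) k :=
  eval₂Hom (rename (Fin.castAdd c)).toRingHom fun j => X (Fin.natAdd m j)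

theorem mergeVars_splitVars (p : MvPolynomial (Fin (m + c)) k) :
    mergeVars k m c (splitVars k m c p) = p := by
  induction p using MvPolynomial.induction_on with
  | C a =>
    rw [← rename_C (Fin.castAdd c), splitVars_rename, mergeVars, eval₂Hom_C]
    rfl
  | add p q hp hq => rw [map_add, map_add, hp, hq]
  | mul_X p i hp =>
    rw [map_mul, map_mul, hp]
    congr 1
    refine Fin.addCases (fun i => ?_) (fun j => ?_) i
    · rw [splitVars_X_castAdd, mergeVars, eval₂Hom_C]
      exact rename_X _ _
    · rw [splitVars_X_natAdd, mergeVars, eval₂Hom_X']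

/-- The degree of a monomial in the last `c` variables. -/
theorem sum_natAdd_le_totalDegree_splitVars {p : MvPolynomial (Fin (m + c)) k}
    {d : Fin (m + c) →₀ ℕ} (hd : d ∈ p.support) :
    ∑ j, d (Fin.natAdd m j) ≤ (splitVars k m c p).totalDegree := by
  classical
  -- Weight 0 on the base variables and 1 on the fibre variables measures the degree along the
  -- fibre. Rebuilding p from its split form bounds this weight by the degree of the split form.
  set w : Fin (m + c) → ℚ := Fin.append (fun _ => 0) (fun _ => 1) with hw
  have hweight : ∀ d : Fin (m + c) →₀ ℕ,
      Finsupp.weight w d = ((∑ j, d (Fin.natAdd m j) : ℕ) : ℚ) := fun d => by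
    rw [Finsupp.weight_apply, Finsupp.sum_fintype _ _ (by simp), Fin.sum_univ_add]
    simp [hw]
  suffices h : WeightLE w (mergeVars k m c (splitVars k m c p)) (splitVars k m c p).totalDegree by
    rw [mergeVars_splitVars] at h
    have := h d hd
    rw [hweight] at this
    exact_mod_cast this
  set q := splitVars k m c p
  have hX : ∀ j : Fin c, WeightLE w (X (Fin.natAdd m j) : MvPolynomial (Fin (m + c)) k) 1 := by
    intro j d hd
    rw [support_X, Finset.mem_singleton] at hd
    rw [hd, hweight]
    simp [Finsupp.single_apply]
  have hbase : ∀ r : MvPolynomial (Fin m) k, WeightLE w (rename (Fin.castAdd c) r) 0 := by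
    intro r d hd
    rw [support_rename_of_injective (Fin.castAdd_injective m c), Finset.mem_image] at hd
    obtain ⟨e, -, rfl⟩ := hd
    rw [hweight, Finset.sum_eq_zero, Nat.cast_zero]
    intro j _
    refine Finsupp.mapDomain_of_notMem_range _ _ ?_
    rintro ⟨i, hi⟩
    have := congrArg Fin.val hi
    simp at this
    omega
  rw [mergeVars, coe_eval₂Hom, eval₂_eq]
  intro d hd
  obtain ⟨e, he, hd⟩ := Finset.mem_biUnion.1 (support_sum hd)
  have h1 := WeightLE.prod e.support fun j => ((hX j).pow (e j)).1
  refine (((hbase (q.coeff e)).mul h1.1) d hd).trans ?_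
  rw [zero_add]
  have h2 := le_totalDegree he
  rw [Finsupp.sum] at h2
  simp only [nsmul_eq_mul, mul_one]
  exact_mod_cast h2

theorem totalDegree_splitVars_le (p : MvPolynomial (Fin (m + c)) k) :
    (splitVars k m c p).totalDegree ≤ p.totalDegree := by
  refine totalDegree_aeval_le (fun i => ?_) p
  refine Fin.addCases (fun i => ?_) (fun j => ?_) i
  · rw [Fin.append_left, totalDegree_C]; exact Nat.zero_le _
  · rw [Fin.append_right]
    cases subsingleton_or_nontrivial (MvPolynomial (Fin m) k)
    · simp
    · rw [totalDegree_X]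

/-- `f` maps the fibres of the projection to the first `m` coordinates to fibres, and induces `g` on
the base. -/
def IsSkewOver (f : AffineEnd k (m + c)) (g : AffineEnd k m) : Prop :=
  ∀ i, f.coord (Fin.castAdd c i) = rename (Fin.castAdd c) (g.coord i)

theorem bind₁_rename_castAdd {f : AffineEnd k (m + c)} {g : AffineEnd k m} (hf : IsSkewOver f g)
    (p : MvPolynomial (Fin m) k) :
    bind₁ f.coord (rename (Fin.castAdd c) p) = rename (Fin.castAdd c) (bind₁ g.coord p) := by
  rw [bind₁, aeval_rename, ← bind₁]
  have : f.coord ∘ Fin.castAdd c = fun i => rename (Fin.castAdd c) (g.coord i) := funext hf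
  rw [this, ← AlgHom.comp_apply]
  refine AlgHom.congr_fun (algHom_ext fun i => ?_) p
  simp

theorem IsSkewOver.mul {f f' : AffineEnd k (m + c)} {g g' : AffineEnd k m} (hf : IsSkewOver f g)
    (hf' : IsSkewOver f' g') : IsSkewOver (f * f') (g * g') := fun i => by
  rw [coord_mul, hf i, bind₁_rename_castAdd hf', coord_mul]

theorem isSkewOver_one : IsSkewOver (1 : AffineEnd k (m + c)) (1 : AffineEnd k m) := fun i => by
  rw [coord_one, coord_one, rename_X]

theorem IsSkewOver.pow {f : AffineEnd k (m + c)} {g : AffineEnd k m} (hf : IsSkewOver f g) (r : ℕ) :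
    IsSkewOver (f ^ r) (g ^ r) := by
  induction r with
  | zero => exact isSkewOver_one
  | succ r ih => rw [pow_succ, pow_succ]; exact ih.mul hf

theorem IsSkewOver.unique {f : AffineEnd k (m + c)} {g g' : AffineEnd k m} (hf : IsSkewOver f g)
    (hf' : IsSkewOver f g') : g = g' := by
  ext1; funext i
  exact rename_injective _ (Fin.castAdd_injective m c) ((hf i).symm.trans (hf' i))

theorem IsSkewOver.degree_le {f : AffineEnd k (m + c)} {g : AffineEnd k m} (hf : IsSkewOver f g) :
    g.degree ≤ f.degree := by
  refine Finset.sup_le fun i _ => ?_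
  refine le_trans ?_ (totalDegree_coord_le f (Fin.castAdd c i))
  rw [hf i]
  refine Finset.sup_le fun d hd => ?_
  have : d.mapDomain (Fin.castAdd c) ∈ (rename (Fin.castAdd c) (g.coord i)).support := by
    classical
    rw [support_rename_of_injective (Fin.castAdd_injective m c)]
    exact Finset.mem_image_of_mem _ hd
  refine le_trans ?_ (le_totalDegree this)
  rw [Finsupp.sum_mapDomain_index (fun _ => rfl) (fun _ _ _ => rfl)]

variable (k m) in
/-- The function field of the base. -/
abbrev BaseField : Type _ := FractionRing (MvPolynomial (Fin m) k)

/-- The generic fibre of `f`, as an endomorphism over the function field of the base. -/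
noncomputable def genericFibre (f : AffineEnd k (m + c)) : AffineEnd (BaseField k m) c :=
  ⟨fun j => map (algebraMap _ _) (splitVars k m c (f.coord (Fin.natAdd m j)))⟩

theorem algebraMap_comp_bind₁_injective (g : (AffineEnd k m)ˣ) :
    Function.Injective ((algebraMap _ (BaseField k m)).comp (bind₁ g.1.coord).toRingHom) := by
  have h : ∀ p, bind₁ (g⁻¹).1.coord (bind₁ g.1.coord p) = p := fun p => by
    rw [bind₁_bind₁]
    simp only [bind₁_inv_coord]
    rw [bind₁_X_left]; rfl
  exact (IsFractionRing.injective _ _).comp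
    (Function.LeftInverse.injective (g := bind₁ (g⁻¹).1.coord) h)

/-- The action of an automorphism of the base on its function field. -/
noncomputable def pullback (g : (AffineEnd k m)ˣ) : BaseField k m →+* BaseField k m :=
  IsFractionRing.lift (algebraMap_comp_bind₁_injective g)

theorem pullback_algebraMap (g : (AffineEnd k m)ˣ) (p : MvPolynomial (Fin m) k) :
    pullback g (algebraMap _ _ p) = algebraMap _ _ (bind₁ g.1.coord p) :=
  IsFractionRing.lift_algebraMap _ _

theorem pullback_comp (g h : (AffineEnd k m)ˣ) :
    (pullback h).comp (pullback g) = pullback (g * h) := by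
  refine IsFractionRing.ringHom_ext (A := MvPolynomial (Fin m) k) fun p => ?_
  rw [RingHom.comp_apply, pullback_algebraMap, pullback_algebraMap, pullback_algebraMap, bind₁_bind₁]
  rfl

theorem pullback_one : pullback (1 : (AffineEnd k m)ˣ) = RingHom.id _ := by
  refine IsFractionRing.ringHom_ext (A := MvPolynomial (Fin m) k) fun p => ?_
  rw [pullback_algebraMap]
  exact congrArg _ (AlgHom.congr_fun (bind₁_X_left (σ := Fin m) (R := k)) p)

/-- Base variables have become coefficients, so substituting f acts on them through the pullback by
g and on the fibre variables through the generic fibre. It suffices to compare on scalars and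
variables. -/
theorem map_splitVars_bind₁ {f : AffineEnd k (m + c)} {g : (AffineEnd k m)ˣ} (hf : IsSkewOver f g.1)
    (p : MvPolynomial (Fin (m + c)) k) :
    map (algebraMap _ (BaseField k m)) (splitVars k m c (bind₁ f.coord p)) =
      bind₁ (genericFibre f).coord
        (map (pullback g) (map (algebraMap _ (BaseField k m)) (splitVars k m c p))) := by
  set α := algebraMap (MvPolynomial (Fin m) k) (BaseField k m) with hα
  have h : (map α).comp ((splitVars k m c).toRingHom.comp (bind₁ f.coord).toRingHom) =
      (bind₁ (genericFibre f).coord).toRingHom.comp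
        ((map (pullback g)).comp ((map α).comp (splitVars k m c).toRingHom)) := by
    refine ringHom_ext (fun a => ?_) fun i => ?_
    · change map α (splitVars k m c (bind₁ f.coord (C a))) =
        bind₁ (genericFibre f).coord (map (pullback g) (map α (splitVars k m c (C a))))
      rw [bind₁_C_right, ← rename_C (Fin.castAdd c), splitVars_rename, map_C, map_C, bind₁_C_right,
        pullback_algebraMap, bind₁_C_right]
    · change map α (splitVars k m c (bind₁ f.coord (X i))) =
        bind₁ (genericFibre f).coord (map (pullback g) (map α (splitVars k m c (X i))))
      rw [bind₁_X_right]
      refine Fin.addCases (fun i => ?_) (fun j => ?_) i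
      · rw [hf, splitVars_rename, splitVars_X_castAdd, map_C, map_C, map_C, bind₁_C_right,
          pullback_algebraMap, bind₁_X_right]
      · rw [splitVars_X_natAdd, map_X, map_X, bind₁_X_right]
        rfl
  exact RingHom.congr_fun h p

theorem genericFibre_mul (f : AffineEnd k (m + c)) {f' : AffineEnd k (m + c)}
    {g' : (AffineEnd k m)ˣ} (hf' : IsSkewOver f' g'.1) :
    genericFibre (f * f') = mapCoeff c (pullback g') (genericFibre f) * genericFibre f' := by
  ext1; funext j
  exact map_splitVars_bind₁ hf' _

theorem genericFibre_one : genericFibre (1 : AffineEnd k (m + c)) = 1 := by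
  ext1; funext j
  change map _ (splitVars k m c (X (Fin.natAdd m j))) = X j
  rw [splitVars_X_natAdd, map_X]

theorem genericFibre_pow {f : AffineEnd k (m + c)} {g : (AffineEnd k m)ˣ} (hf : IsSkewOver f g.1)
    (r : ℕ) : genericFibre (f ^ r) = twistedPow (mapCoeff c (pullback g)) (genericFibre f) r := by
  induction r with
  | zero => exact genericFibre_one
  | succ r ih => rw [pow_succ, genericFibre_mul _ hf, ih, twistedPow]

theorem mapCoeff_comp {K L M : Type*} [Field K] [Field L] [Field M] (σ : K →+* L) (τ : L →+* M)
    {n : ℕ} (f : AffineEnd K n) : mapCoeff n τ (mapCoeff n σ f) = mapCoeff n (τ.comp σ) f := by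
  ext1; funext i
  exact map_map _ _ _

theorem mapCoeff_id {K : Type*} [Field K] {n : ℕ} (f : AffineEnd K n) :
    mapCoeff n (RingHom.id K) f = f := by
  ext1; funext i
  exact map_id _

/-- The inverse is the generic fibre of f⁻¹ twisted by the pullback of g. One of the two identities
appears only after twisting the relation for f f⁻¹ = 1. -/
theorem isUnit_genericFibre {f : (AffineEnd k (m + c))ˣ} {g : (AffineEnd k m)ˣ}
    (hf : IsSkewOver f.1 g.1) (hf' : IsSkewOver (f⁻¹).1 (g⁻¹).1) : IsUnit (genericFibre f.1) := by
  have h1 := genericFibre_mul f.1 hf'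
  have h2 := genericFibre_mul (f⁻¹).1 hf
  rw [Units.mul_inv, genericFibre_one] at h1
  rw [Units.inv_mul, genericFibre_one] at h2
  have h3 := congrArg (mapCoeff c (pullback g)) h1
  rw [map_one, map_mul, mapCoeff_comp, pullback_comp, inv_mul_cancel, pullback_one,
    mapCoeff_id] at h3
  exact ⟨⟨_, _, h3.symm, h2.symm⟩, rfl⟩

theorem totalDegree_genericFibre (f : AffineEnd k (m + c)) (j : Fin c) :
    ((genericFibre f).coord j).totalDegree =
      (splitVars k m c (f.coord (Fin.natAdd m j))).totalDegree := by
  rw [genericFibre, totalDegree, totalDegree,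
    support_map_of_injective _ (IsFractionRing.injective _ _)]

theorem degree_genericFibre_le (f : AffineEnd k (m + c)) : (genericFibre f).degree ≤ f.degree := by
  refine Finset.sup_le fun j _ => ?_
  rw [totalDegree_genericFibre]
  exact (totalDegree_splitVars_le _).trans (totalDegree_coord_le _ _)

/-- A monomial of f has at most deg f base variables, replaced by polynomials of degree at most deg
g', and at most as many fibre variables as the degree of the generic fibre, replaced by polynomials
of degree at most deg f'. -/
theorem IsSkewOver.degree_mul_le (f : AffineEnd k (m + c)) {g : AffineEnd k m} (hf : IsSkewOver f g)
    {f' : AffineEnd k (m + c)} {g' : AffineEnd k m} (hf' : IsSkewOver f' g') :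
    (f * f').degree ≤ f.degree * g'.degree + (genericFibre f).degree * f'.degree := by
  refine Finset.sup_le fun i _ => ?_
  refine Fin.addCases (fun i => ?_) (fun j => ?_) i
  · rw [hf.mul hf' i]
    refine (totalDegree_rename_le _ _).trans ((totalDegree_coord_le _ _).trans ?_)
    refine (AffineEnd.degree_mul_le g g').trans ?_
    exact (Nat.mul_le_mul_right _ hf.degree_le).trans (Nat.le_add_right _ _)
  · rw [coord_mul, bind₁_eq_sum]
    refine totalDegree_finsetSum_le fun d hd => ?_
    refine (totalDegree_mul _ _).trans ?_
    rw [totalDegree_C, zero_add]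
    have hprod : ∏ i ∈ d.support, f'.coord i ^ d i = ∏ i, f'.coord i ^ d i :=
      Finsupp.prod_fintype d _ (fun i => pow_zero _)
    rw [hprod]
    refine (totalDegree_finsetProd _ _).trans ?_
    rw [Fin.sum_univ_add]
    have hd1 : ∑ i, d (Fin.castAdd c i) ≤ f.degree := by
      refine le_trans ?_ ((le_totalDegree hd).trans (totalDegree_coord_le _ _))
      rw [Finsupp.sum_fintype _ _ (fun _ => rfl), Fin.sum_univ_add]
      exact Nat.le_add_right _ _
    have hd2 : ∑ j, d (Fin.natAdd m j) ≤ (genericFibre f).degree := by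
      refine (sum_natAdd_le_totalDegree_splitVars hd).trans ?_
      rw [← totalDegree_genericFibre]
      exact totalDegree_coord_le _ _
    have hpow : ∀ i : Fin (m + c), ∀ e, (f'.coord i).totalDegree ≤ e →
        (f'.coord i ^ d i).totalDegree ≤ d i * e := fun i e he =>
      (totalDegree_pow _ _).trans (Nat.mul_le_mul_left _ he)
    refine Nat.add_le_add ?_ ?_
    · refine le_trans ?_ (Nat.mul_le_mul_right g'.degree hd1)
      rw [Finset.sum_mul]
      refine Finset.sum_le_sum fun i _ => hpow _ _ ?_
      rw [hf' i]
      exact (totalDegree_rename_le _ _).trans (totalDegree_coord_le _ _)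
    · refine le_trans ?_ (Nat.mul_le_mul_right f'.degree hd2)
      rw [Finset.sum_mul]
      exact Finset.sum_le_sum fun j _ => hpow _ _ (totalDegree_coord_le _ _)

end AffineEnd

end

/-! ### The dynamical degree of a skew product -/

section

section SkewGrowth

open Filter Topology

theorem lt_pow_of_root_lt {u : ℕ} {ρ : ℝ} {r : ℕ} (hr : r ≠ 0)
    (h : (u : ℝ) ^ (1 / (r : ℝ)) < ρ) : (u : ℝ) < ρ ^ r := by
  have h0 : (0 : ℝ) ≤ (u : ℝ) ^ (1 / (r : ℝ)) := by positivity
  have h1 := pow_lt_pow_left₀ h h0 hr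
  rwa [one_div, Real.rpow_inv_natCast_pow (Nat.cast_nonneg _) hr] at h1

/-- The growth rate of a sequence that is controlled by a base sequence `G` and a fibre
sequence `D`. -/
theorem root_limit_eq_max {e G D : ℕ → ℕ} (hG : ∀ r, G r ≤ e r) (hD : ∀ r, D r ≤ e r)
    (hsub : ∀ s r, e (s + r) ≤ e s * G r + D s * e r) {lam gam mu : ℝ}
    (he : Tendsto (fun r : ℕ => (e r : ℝ) ^ (1 / (r : ℝ))) atTop (𝓝 lam))
    (hg : Tendsto (fun r : ℕ => (G r : ℝ) ^ (1 / (r : ℝ))) atTop (𝓝 gam))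
    (hm : Tendsto (fun r : ℕ => (D r : ℝ) ^ (1 / (r : ℝ))) atTop (𝓝 mu)) :
    lam = max gam mu := by
  have hle : ∀ {u : ℕ → ℕ}, (∀ r, u r ≤ e r) → ∀ r : ℕ,
      (u r : ℝ) ^ (1 / (r : ℝ)) ≤ (e r : ℝ) ^ (1 / (r : ℝ)) := fun hu r =>
    Real.rpow_le_rpow (Nat.cast_nonneg _) (by exact_mod_cast hu r) (by positivity)
  refine le_antisymm ?_ (max_le (le_of_tendsto_of_tendsto' hg he (hle hG))
    (le_of_tendsto_of_tendsto' hm he (hle hD)))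
  by_contra! hlt
  -- For a large fixed s one has D s < ρ^s, and G r ≤ ρ^r for all r ≥ s. The recursion then bounds e
  -- by a multiple of ρ^r along the multiples r of s, which contradicts ρ < lam.
  obtain ⟨ρ, hρ1, hρ2⟩ := exists_between hlt
  have hgam := (le_max_left gam mu).trans_lt hρ1
  have hmu := (le_max_right gam mu).trans_lt hρ1
  have hmu0 : 0 ≤ mu := ge_of_tendsto' hm fun r => by positivity
  have hρ : 0 < ρ := hmu0.trans_lt hmu
  obtain ⟨r₀, hr₀⟩ := eventually_atTop.1 ((hg.eventually (gt_mem_nhds hgam)).and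
    ((hm.eventually (gt_mem_nhds hmu)).and (eventually_ge_atTop 1)))
  set s := r₀ + 1 with hs
  have hDs : (D s : ℝ) < ρ ^ s := lt_pow_of_root_lt (by omega) (hr₀ s (by omega)).2.1
  have hGr : ∀ r, s ≤ r → (G r : ℝ) ≤ ρ ^ r := fun r hr =>
    (lt_pow_of_root_lt (by omega) (hr₀ r (by omega)).1).le
  have hpos : 0 < ρ ^ s - D s := sub_pos.2 hDs
  -- The solution of e_s + D_s B = B ρ^s, so that the bound e r ≤ B ρ^r reproduces itself when r
  -- grows by s.
  set B := e s / (ρ ^ s - D s) with hB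
  have hB0 : 0 ≤ B := by positivity
  have hBs : e s + D s * B = B * ρ ^ s := by
    rw [hB]
    field_simp
    ring
  have hind : ∀ j : ℕ, (e ((j + 1) * s) : ℝ) ≤ B * ρ ^ ((j + 1) * s) := by
    intro j
    induction j with
    | zero =>
      have : (0 : ℝ) ≤ D s * B := by positivity
      rw [zero_add, one_mul]
      linarith
    | succ j ih =>
      set r := (j + 1) * s with hr
      have hsr : s ≤ r := Nat.le_mul_of_pos_left s (Nat.succ_pos j)
      have h1 : (e (s + r) : ℝ) ≤ e s * G r + D s * e r := by exact_mod_cast hsub s r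
      have h2 : (e s : ℝ) * G r ≤ e s * ρ ^ r := mul_le_mul_of_nonneg_left (hGr r hsr) (by positivity)
      have h3 : (D s : ℝ) * e r ≤ D s * (B * ρ ^ r) := mul_le_mul_of_nonneg_left ih (by positivity)
      have h4 : (j + 1 + 1) * s = s + r := by rw [hr]; ring
      rw [h4, pow_add, ← mul_assoc, ← hBs]
      linarith
  have htop : Tendsto (fun j : ℕ => (j + 1) * s) atTop atTop :=
    tendsto_atTop_mono (fun j => Nat.le_trans (Nat.le_succ j) (Nat.le_mul_of_pos_right _ (by omega)))
      tendsto_id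
  -- The constant is B + 1 because B may be zero.
  have hlim := ((tendsto_const_rpow_one_div (show 0 < B + 1 by positivity)).mul_const ρ).comp htop
  rw [one_mul] at hlim
  refine hρ2.not_ge (le_of_tendsto_of_tendsto' (he.comp htop) hlim fun j => ?_)
  have hne : (j + 1) * s ≠ 0 := Nat.mul_ne_zero (by omega) (by omega)
  simp only [Function.comp_apply]
  calc ((e ((j + 1) * s) : ℕ) : ℝ) ^ (1 / (((j + 1) * s : ℕ) : ℝ))
      ≤ ((B + 1) * ρ ^ ((j + 1) * s)) ^ (1 / (((j + 1) * s : ℕ) : ℝ)) := by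
        refine Real.rpow_le_rpow (by positivity) ((hind j).trans ?_) (by positivity)
        exact mul_le_mul_of_nonneg_right (by linarith) (by positivity)
    _ = (B + 1) ^ (1 / (((j + 1) * s : ℕ) : ℝ)) * ρ := by
        rw [Real.mul_rpow (by positivity) (by positivity)]
        congr 1
        rw [one_div, Real.pow_rpow_inv_natCast hρ.le hne]

end SkewGrowth

namespace AffineEnd

open MvPolynomial Filter Topology

variable {k : Type*} [Field k] {m c : ℕ}

/-- In one variable leading forms are nonzero multiples of powers of x, so degrees multiply under
composition. Hence the degrees of φ and φ⁻¹ have product at most 1. -/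
theorem degree_le_one_of_dim_one (φ : (AffineEnd k 1)ˣ) : φ.1.degree ≤ 1 := by
  classical
  refine Finset.sup_le fun i _ => ?_
  set D := (φ.1.coord i).totalDegree with hD
  set E := ((φ⁻¹).1.coord 0).totalDegree with hE
  have hEpos : 0 < E := totalDegree_coord_pos φ⁻¹ 0
  have hDpos : 0 < D := totalDegree_coord_pos φ i
  have h := homogeneousComponent_bind₁ (F := (φ⁻¹).1.coord) hEpos
    (fun j => by rw [Subsingleton.elim j 0]) hD.ge
  rw [bind₁_inv_coord] at h
  set H := homogeneousComponent D (φ.1.coord i) with hH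
  have hH0 : H ≠ 0 := homogeneousComponent_totalDegree_ne_zero fun h => by
    rw [h, totalDegree_zero] at hD
    omega
  have hHm : H = C (coeff (Finsupp.single 0 D) H) * X 0 ^ D := by
    ext d
    rw [coeff_C_mul, coeff_X_pow]
    split_ifs with hd
    · rw [hd, mul_one]
    · rw [mul_zero]
      refine (homogeneousComponent_isHomogeneous D (φ.1.coord i)).coeff_eq_zero fun hdeg => hd ?_
      rw [Finsupp.degree_eq_sum, Fin.sum_univ_one] at hdeg
      refine Finsupp.ext fun j => ?_
      rw [Subsingleton.elim j 0, Finsupp.single_eq_same, hdeg]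
  have hc : coeff (Finsupp.single 0 D) H ≠ 0 := by
    intro h0
    rw [h0, C_0, zero_mul] at hHm
    exact hH0 hHm
  have hF0 : homogeneousComponent E ((φ⁻¹).1.coord 0) ≠ 0 :=
    homogeneousComponent_totalDegree_ne_zero fun h => by
      rw [h, totalDegree_zero] at hE
      omega
  have hne : homogeneousComponent (D * E) (X i : MvPolynomial (Fin 1) k) ≠ 0 := by
    rw [h, hHm, map_mul, map_pow, bind₁_C_right, bind₁_X_right]
    refine mul_ne_zero ?_ (pow_ne_zero _ hF0)
    rwa [Ne, C_eq_zero]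
  by_contra hcon
  refine hne (homogeneousComponent_eq_zero _ _ ?_)
  rw [totalDegree_X]
  nlinarith

theorem dynamicalDegree_eq_one_of_dim_one (φ : (AffineEnd k 1)ˣ) : φ.1.dynamicalDegree = 1 := by
  refine tendsto_nhds_unique (tendsto_dynamicalDegree φ.1) ?_
  refine tendsto_root_of_bounded (C := 1) (fun r => ?_) fun r => ?_
  · rw [← Units.val_pow_eq_pow_val]; exact degree_pos _
  · rw [← Units.val_pow_eq_pow_val]; exact degree_le_one_of_dim_one _

theorem isSkewOver_pow_inv {f : (AffineEnd k (m + c))ˣ} {g : (AffineEnd k m)ˣ}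
    (hf' : IsSkewOver (f⁻¹).1 (g⁻¹).1) (r : ℕ) : IsSkewOver ((f ^ r)⁻¹).1 ((g ^ r)⁻¹).1 := by
  rw [← inv_pow, ← inv_pow, Units.val_pow_eq_pow_val, Units.val_pow_eq_pow_val]
  exact hf'.pow r

/-- The dynamical degree of a skew product is the maximum of the dynamical degrees of the base and
of the generic fibre. -/
theorem dynamicalDegree_eq_max {f : AffineEnd k (m + c)} {g : AffineEnd k m} (hf : IsSkewOver f g)
    {mu : ℝ} (hmu : Tendsto (fun r : ℕ => ((genericFibre (f ^ r)).degree : ℝ) ^ (1 / (r : ℝ))) atTop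
      (𝓝 mu)) : f.dynamicalDegree = max g.dynamicalDegree mu :=
  root_limit_eq_max (fun r => (hf.pow r).degree_le) (fun r => degree_genericFibre_le (f ^ r))
    (fun s r => by rw [pow_add]; exact IsSkewOver.degree_mul_le _ (hf.pow s) (hf.pow r))
    (tendsto_dynamicalDegree f) (tendsto_dynamicalDegree g) hmu

theorem tendsto_genericFibre_of_dim_one {f : (AffineEnd k (m + 1))ˣ} {g : (AffineEnd k m)ˣ}
    (hf : IsSkewOver f.1 g.1) (hf' : IsSkewOver (f⁻¹).1 (g⁻¹).1) :
    Tendsto (fun r : ℕ => ((genericFibre (f.1 ^ r)).degree : ℝ) ^ (1 / (r : ℝ))) atTop (𝓝 1) := by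
  have hu : ∀ r, IsUnit (genericFibre (f.1 ^ r)) := fun r => by
    rw [← Units.val_pow_eq_pow_val]
    refine isUnit_genericFibre (g := g ^ r) ?_ (isSkewOver_pow_inv hf' r)
    rw [Units.val_pow_eq_pow_val, Units.val_pow_eq_pow_val]
    exact hf.pow r
  refine tendsto_root_of_bounded (C := 1) (fun r => ?_) fun r => ?_
  · exact degree_pos (hu r).unit
  · exact degree_le_one_of_dim_one (hu r).unit

theorem exists_tendsto_genericFibre_of_dim_two {f : (AffineEnd k (m + 2))ˣ} {g : (AffineEnd k m)ˣ}
    (hf : IsSkewOver f.1 g.1) (hf' : IsSkewOver (f⁻¹).1 (g⁻¹).1) :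
    ∃ d : ℕ, Tendsto (fun r : ℕ => ((genericFibre (f.1 ^ r)).degree : ℝ) ^ (1 / (r : ℝ))) atTop
      (𝓝 (d : ℝ)) := by
  obtain ⟨d, hd⟩ := exists_tendsto_degree_twistedPow (pullback g) (isUnit_genericFibre hf hf').unit
  refine ⟨d, hd.congr fun r => ?_⟩
  rw [genericFibre_pow hf]
  rfl

end AffineEnd

end

/-! ### Linear projections and preserved fibres -/

section

open MvPolynomial

namespace AffineEnd

variable {k : Type*} [Field k] {n m c : ℕ}

/-- The linear endomorphism with a given matrix. -/
noncomputable def ofMatrix (A : Matrix (Fin n) (Fin n) k) : AffineEnd k n :=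
  ⟨fun i => ∑ j, C (A i j) * X j⟩

theorem ofMatrix_mul (A B : Matrix (Fin n) (Fin n) k) :
    ofMatrix (A * B) = ofMatrix A * ofMatrix B := by
  ext1; funext i
  rw [coord_mul]
  simp only [ofMatrix, map_sum, map_mul, bind₁_C_right, bind₁_X_right, Matrix.mul_apply,
    Finset.mul_sum, Finset.sum_mul]
  rw [Finset.sum_comm]
  simp only [mul_assoc]

theorem ofMatrix_one : ofMatrix (1 : Matrix (Fin n) (Fin n) k) = 1 := by
  ext1; funext i
  change (∑ j, C ((1 : Matrix (Fin n) (Fin n) k) i j) * X j) = X i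
  rw [Finset.sum_eq_single i]
  · simp
  · intro j _ hj
    simp [Matrix.one_apply_ne hj.symm]
  · simp

theorem onPoints_mul (f g : AffineEnd k n) (K : Type*) [Field K] [Algebra k K] (x : Fin n → K) :
    (f * g).onPoints K x = f.onPoints K (g.onPoints K x) := by
  funext i
  exact aeval_bind₁ _ _ _

theorem onPoints_one (K : Type*) [Field K] [Algebra k K] (x : Fin n → K) :
    (1 : AffineEnd k n).onPoints K x = x := by
  funext i
  exact aeval_X _ _

theorem onPoints_inv_onPoints (f : (AffineEnd k n)ˣ) (K : Type*) [Field K] [Algebra k K]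
    (x : Fin n → K) : (f⁻¹).1.onPoints K (f.1.onPoints K x) = x := by
  rw [← onPoints_mul, Units.inv_mul, onPoints_one]

theorem onPoints_onPoints_inv (f : (AffineEnd k n)ˣ) (K : Type*) [Field K] [Algebra k K]
    (x : Fin n → K) : f.1.onPoints K ((f⁻¹).1.onPoints K x) = x := by
  rw [← onPoints_mul, Units.mul_inv, onPoints_one]

/-- A surjective linear map to `kᵐ` extends to a linear coordinate system. -/
theorem exists_linearEquiv_extending (A : Matrix (Fin m) (Fin (m + c)) k)
    (hA : Function.Surjective A.mulVec) :
    ∃ L : (Fin (m + c) → k) ≃ₗ[k] (Fin (m + c) → k), ∀ x i, L x (Fin.castAdd c i) = A.mulVec x i := by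
  set φ := A.mulVecLin with hφ
  have hφs : Function.Surjective φ := hA
  obtain ⟨s, hs⟩ := φ.exists_rightInverse_of_surjective (LinearMap.range_eq_top.2 hφs)
  have hdim : Module.finrank k (LinearMap.ker φ) = c := by
    have h := φ.finrank_range_add_finrank_ker
    rw [LinearMap.range_eq_top.2 hφs, finrank_top, Module.finrank_fin_fun,
      Module.finrank_fin_fun] at h
    omega
  let b := Module.finBasisOfFinrankEq k (LinearMap.ker φ) hdim
  have hs' : ∀ y, φ (s y) = y := fun y => LinearMap.congr_fun hs y
  -- The projection to the kernel along the section s. Its coordinates in a basis of the kernel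
  -- complete φ to a coordinate system.
  let p : (Fin (m + c) → k) →ₗ[k] LinearMap.ker φ :=
    (LinearMap.id - s ∘ₗ φ).codRestrict _ fun x => by simp [hs']
  let T : (Fin (m + c) → k) →ₗ[k] (Fin (m + c) → k) :=
    LinearMap.pi (Fin.append (fun i => LinearMap.proj i ∘ₗ φ)
      fun j => LinearMap.proj j ∘ₗ b.equivFun.toLinearMap ∘ₗ p)
  have hT1 : ∀ x i, T x (Fin.castAdd c i) = φ x i := fun x i => by
    simp only [T, LinearMap.pi_apply, Fin.append_left]
    rfl
  have hT2 : ∀ x j, T x (Fin.natAdd m j) = b.equivFun (p x) j := fun x i => by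
    simp only [T, LinearMap.pi_apply, Fin.append_right]
    rfl
  have hinj : Function.Injective T := by
    refine (injective_iff_map_eq_zero T).2 fun x hx => ?_
    have h1 : φ x = 0 := funext fun i => by rw [← hT1, hx]; rfl
    have h2 : p x = 0 := by
      refine b.equivFun.injective ?_
      rw [map_zero]
      funext j
      rw [← hT2, hx]; rfl
    have h3 := congrArg Subtype.val h2
    simpa [p, h1] using h3
  exact ⟨LinearEquiv.ofInjectiveEndo T hinj, fun x i => hT1 x i⟩

/-- A linear projection becomes the projection to the first coordinates in suitable linear
coordinates. -/
theorem exists_unit_extending (π : LinearProjection k (m + c) m) :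
    ∃ θ : (AffineEnd k (m + c))ˣ, ∀ (K : Type _) [Field K] [Algebra k K] (x : Fin (m + c) → K) (i : Fin m),
      θ.1.onPoints K x (Fin.castAdd c i) = π.onPoints K x i := by
  obtain ⟨L, hL⟩ := exists_linearEquiv_extending π.matrix π.surjective
  set A := LinearMap.toMatrix' L.toLinearMap with hA
  set B := LinearMap.toMatrix' L.symm.toLinearMap with hB
  have hAB : A * B = 1 := by
    rw [hA, hB, ← LinearMap.toMatrix'_comp, LinearEquiv.comp_symm, LinearMap.toMatrix'_id]
  have hBA : B * A = 1 := by
    rw [hA, hB, ← LinearMap.toMatrix'_comp, LinearEquiv.symm_comp, LinearMap.toMatrix'_id]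
  refine ⟨⟨ofMatrix A, ofMatrix B, by rw [← ofMatrix_mul, hAB, ofMatrix_one],
    by rw [← ofMatrix_mul, hBA, ofMatrix_one]⟩, fun K _ _ x i => ?_⟩
  have hrow : ∀ j, A (Fin.castAdd c i) j = π.matrix i j := fun j => by
    rw [hA, LinearMap.toMatrix'_apply]
    change L _ _ = _
    rw [hL]
    simp [Matrix.mulVec, dotProduct, Pi.single_apply]
  simp only [onPoints, ofMatrix, map_sum, map_mul, aeval_X, hrow, LinearProjection.onPoints,
    Matrix.mulVec, dotProduct, Matrix.map_apply, ← algebraMap_eq, AlgHom.commutes]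

theorem PreservesFibres.onPoints_eq {f : AffineEnd k n} {π : LinearProjection k n m}
    (hf : f.PreservesFibres π) {x y : Fin n → AlgebraicClosure k}
    (hxy : π.onPoints _ x = π.onPoints _ y) :
    π.onPoints _ (f.onPoints _ x) = π.onPoints _ (f.onPoints _ y) := by
  obtain ⟨t, ht⟩ := hf _ ⟨π.onPoints _ x, rfl⟩
  replace ht : π.onPoints (AlgebraicClosure k) ⁻¹' {t} = f.onPoints (AlgebraicClosure k) ''
    (π.onPoints (AlgebraicClosure k) ⁻¹' {π.onPoints _ x}) := ht
  have h : ∀ z, π.onPoints _ z = π.onPoints _ x →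
      π.onPoints _ (f.onPoints (AlgebraicClosure k) z) = t := fun z hz => by
    have : f.onPoints (AlgebraicClosure k) z ∈ π.onPoints (AlgebraicClosure k) ⁻¹' {t} := by
      rw [ht]
      exact ⟨z, hz, rfl⟩
    exact this
  rw [h x rfl, h y hxy.symm]

/-- The fibre through f⁻¹(x) is mapped onto a whole fibre, namely the one through x, which also
contains y. Mere inclusion of the image in a fibre would not suffice. -/
theorem PreservesFibres.onPoints_inv_eq {f : (AffineEnd k n)ˣ} {π : LinearProjection k n m}
    (hf : f.1.PreservesFibres π) {x y : Fin n → AlgebraicClosure k}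
    (hxy : π.onPoints _ x = π.onPoints _ y) :
    π.onPoints _ ((f⁻¹).1.onPoints _ x) = π.onPoints _ ((f⁻¹).1.onPoints _ y) := by
  obtain ⟨t, ht⟩ := hf _ ⟨π.onPoints _ ((f⁻¹).1.onPoints _ x), rfl⟩
  replace ht : π.onPoints (AlgebraicClosure k) ⁻¹' {t} = f.1.onPoints (AlgebraicClosure k) ''
    (π.onPoints (AlgebraicClosure k) ⁻¹' {π.onPoints _ ((f⁻¹).1.onPoints _ x)}) := ht
  have hx : x ∈ π.onPoints (AlgebraicClosure k) ⁻¹' {t} := by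
    rw [ht]
    exact ⟨_, rfl, onPoints_onPoints_inv f _ x⟩
  have hy : y ∈ π.onPoints (AlgebraicClosure k) ⁻¹' {t} := by
    rw [Set.mem_preimage, Set.mem_singleton_iff] at hx ⊢
    rw [← hxy, hx]
  rw [ht] at hy
  obtain ⟨z, hz, rfl⟩ := hy
  rw [onPoints_inv_onPoints]
  exact hz.symm

/-- An endomorphism that maps fibres of the projection to the first coordinates into fibres induces
an endomorphism of the base. -/
theorem exists_isSkewOver {f : AffineEnd k (m + c)}
    (hf : ∀ x y : Fin (m + c) → AlgebraicClosure k,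
      (∀ i, x (Fin.castAdd c i) = y (Fin.castAdd c i)) →
      ∀ i, f.onPoints _ x (Fin.castAdd c i) = f.onPoints _ y (Fin.castAdd c i)) :
    ∃ g : AffineEnd k m, IsSkewOver f g := by
  -- The base map is read off on the section where the fibre coordinates are 0. The polynomial
  -- identity is tested on points over the algebraic closure, which is infinite even if k is finite.
  refine ⟨⟨fun i => bind₁ (Fin.append X 0) (f.coord (Fin.castAdd c i))⟩, fun i => ?_⟩
  have hinj := (algebraMap k (AlgebraicClosure k)).injective
  have : Infinite (AlgebraicClosure k) := inferInstance
  refine map_injective _ hinj (MvPolynomial.funext fun x => ?_)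
  rw [eval_map, eval_map, ← aeval_def, ← aeval_def, aeval_rename]
  change _ = aeval _ (bind₁ (Fin.append X 0) (f.coord (Fin.castAdd c i)))
  rw [aeval_bind₁]
  refine (hf x (Fin.append (x ∘ Fin.castAdd c) 0) (fun i => ?_) i).trans ?_
  · rw [Fin.append_left]; rfl
  · rw [onPoints]
    congr 2
    funext j
    refine Fin.addCases (fun i => ?_) (fun j => ?_) j
    · rw [Fin.append_left, Fin.append_left, aeval_X]
    · rw [Fin.append_right, Fin.append_right]
      simp

/-- Both f and f⁻¹ descend to the base. The induced maps are mutually inverse because the map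
induced by the identity is unique, so the base map is an automorphism. -/
theorem exists_isSkewOver_conj {f : (AffineEnd k (m + c))ˣ} {π : LinearProjection k (m + c) m}
    (hf : f.1.PreservesFibres π) :
    ∃ (θ : (AffineEnd k (m + c))ˣ) (g : (AffineEnd k m)ˣ),
      IsSkewOver (θ * f * θ⁻¹).1 g.1 ∧ IsSkewOver ((θ * f * θ⁻¹)⁻¹).1 (g⁻¹).1 := by
  obtain ⟨θ, hθ⟩ := exists_unit_extending π
  have hconj : ∀ h : (AffineEnd k (m + c))ˣ,
      (∀ x y, π.onPoints (AlgebraicClosure k) x = π.onPoints _ y →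
        π.onPoints _ (h.1.onPoints _ x) = π.onPoints _ (h.1.onPoints _ y)) →
      ∃ g : AffineEnd k m, IsSkewOver (θ * h * θ⁻¹).1 g := by
    intro h hh
    refine exists_isSkewOver fun x y hxy i => ?_
    rw [Units.val_mul, Units.val_mul, onPoints_mul, onPoints_mul, onPoints_mul, onPoints_mul, hθ, hθ]
    refine congrFun (hh _ _ (funext fun i => ?_)) i
    rw [← hθ, ← hθ, onPoints_onPoints_inv, onPoints_onPoints_inv, hxy]
  obtain ⟨g, hg⟩ := hconj f fun x y => hf.onPoints_eq
  obtain ⟨g', hg'⟩ := hconj f⁻¹ fun x y => hf.onPoints_inv_eq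
  have hinv : θ * f⁻¹ * θ⁻¹ = (θ * f * θ⁻¹)⁻¹ := by group
  rw [hinv] at hg'
  have h1 : g * g' = 1 := by
    have := hg.mul hg'
    rw [Units.mul_inv] at this
    exact this.unique isSkewOver_one
  have h2 : g' * g = 1 := by
    have := hg'.mul hg
    rw [Units.inv_mul] at this
    exact this.unique isSkewOver_one
  exact ⟨θ, ⟨g, g', h1, h2⟩, hg, hg'⟩

theorem dynamicalDegree_conj (θ f : (AffineEnd k n)ˣ) :
    (θ * f * θ⁻¹).1.dynamicalDegree = f.1.dynamicalDegree := by
  have hle : ∀ θ f : (AffineEnd k n)ˣ,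
      (θ * f * θ⁻¹).1.degree ≤ θ.1.degree * (θ⁻¹).1.degree * f.1.degree := fun θ f => by
    have h1 := degree_mul_le (θ * f).1 (θ⁻¹).1
    have h2 := degree_mul_le θ.1 f.1
    calc (θ * f * θ⁻¹).1.degree ≤ (θ * f).1.degree * (θ⁻¹).1.degree := h1
      _ ≤ θ.1.degree * f.1.degree * (θ⁻¹).1.degree := Nat.mul_le_mul_right _ h2
      _ = _ := by ring
  refine tendsto_nhds_unique (tendsto_dynamicalDegree _) ?_
  -- The summand 1 keeps the constant positive in dimension 0, where all degrees vanish.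
  refine tendsto_root_of_le_mul (C := (θ.1.degree * (θ⁻¹).1.degree + 1 : ℕ)) (by positivity)
    (fun r => ?_) (fun r => ?_) (tendsto_dynamicalDegree f.1)
  · rw [← Units.val_pow_eq_pow_val, ← Units.val_pow_eq_pow_val, conj_pow]
    have h := hle θ⁻¹ (θ * f ^ r * θ⁻¹)
    have h2 : θ⁻¹ * (θ * f ^ r * θ⁻¹) * θ⁻¹⁻¹ = f ^ r := by group
    rw [h2, inv_inv, mul_comm (θ⁻¹).1.degree] at h
    exact_mod_cast h.trans (Nat.mul_le_mul_right _ (Nat.le_succ _))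
  · rw [← Units.val_pow_eq_pow_val, ← Units.val_pow_eq_pow_val, conj_pow]
    exact_mod_cast (hle θ (f ^ r)).trans (Nat.mul_le_mul_right _ (Nat.le_succ _))

theorem exists_dynamicalDegree_eq_of_fibre_dim_two
    (hbase : ∀ g : (AffineEnd k m)ˣ, ∃ d : ℕ, g.1.dynamicalDegree = d)
    {f : (AffineEnd k (m + 2))ˣ} {π : LinearProjection k (m + 2) m} (hf : f.1.PreservesFibres π) :
    ∃ d : ℕ, f.1.dynamicalDegree = d := by
  obtain ⟨θ, g, hg, hg'⟩ := exists_isSkewOver_conj hf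
  obtain ⟨d, hd⟩ := hbase g
  obtain ⟨e, he⟩ := exists_tendsto_genericFibre_of_dim_two hg hg'
  refine ⟨max d e, ?_⟩
  rw [← dynamicalDegree_conj θ f, dynamicalDegree_eq_max hg he, hd, Nat.cast_max]

theorem exists_dynamicalDegree_eq_of_fibre_dim_one
    (hbase : ∀ g : (AffineEnd k m)ˣ, ∃ d : ℕ, g.1.dynamicalDegree = d)
    {f : (AffineEnd k (m + 1))ˣ} {π : LinearProjection k (m + 1) m} (hf : f.1.PreservesFibres π) :
    ∃ d : ℕ, f.1.dynamicalDegree = d := by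
  obtain ⟨θ, g, hg, hg'⟩ := exists_isSkewOver_conj hf
  obtain ⟨d, hd⟩ := hbase g
  refine ⟨max d 1, ?_⟩
  rw [← dynamicalDegree_conj θ f, dynamicalDegree_eq_max hg (tendsto_genericFibre_of_dim_one hg hg'),
    hd, Nat.cast_max, Nat.cast_one]

end AffineEnd

end

theorem mainTheorem8 (k : Type*) [Field k] :
    (∀ f : (AffineEnd k 2)ˣ, ∃ d : ℤ, (f : AffineEnd k 2).dynamicalDegree = (d : ℝ)) ∧
    (∀ f : (AffineEnd k 3)ˣ,
      ((∃ π : LinearProjection k 3 1, (f : AffineEnd k 3).PreservesFibres π) ∨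
        (∃ π : LinearProjection k 3 2, (f : AffineEnd k 3).PreservesFibres π)) →
      ∃ d : ℤ, (f : AffineEnd k 3).dynamicalDegree = (d : ℝ)) ∧
    (∀ f : (AffineEnd k 4)ˣ,
      (∃ π : LinearProjection k 4 2, (f : AffineEnd k 4).PreservesFibres π) →
      ∃ d : ℤ, (f : AffineEnd k 4).dynamicalDegree = (d : ℝ)) := by
  refine ⟨fun f => ?_, fun f hf => ?_, fun f hf => ?_⟩
  · obtain ⟨d, hd⟩ := AffineEnd.exists_dynamicalDegree_eq_natCast f
    exact ⟨d, by rw [hd, Int.cast_natCast]⟩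
  · obtain ⟨d, hd⟩ : ∃ d : ℕ, (f : AffineEnd k 3).dynamicalDegree = d := by
      obtain ⟨π, hπ⟩ | ⟨π, hπ⟩ := hf
      · exact AffineEnd.exists_dynamicalDegree_eq_of_fibre_dim_two (m := 1)
          (fun g => ⟨1, by rw [AffineEnd.dynamicalDegree_eq_one_of_dim_one, Nat.cast_one]⟩) hπ
      · exact AffineEnd.exists_dynamicalDegree_eq_of_fibre_dim_one (m := 2)
          AffineEnd.exists_dynamicalDegree_eq_natCast hπ
    exact ⟨d, by rw [hd, Int.cast_natCast]⟩
  · obtain ⟨π, hπ⟩ := hf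
    obtain ⟨d, hd⟩ := AffineEnd.exists_dynamicalDegree_eq_of_fibre_dim_two (m := 2)
      AffineEnd.exists_dynamicalDegree_eq_natCast hπ
    exact ⟨d, by rw [hd, Int.cast_natCast]⟩
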